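/- **Setting.** Let $a>1$, $-1<r<1/a$, $\sigma>0$ and $\psi\ge 1$ be fixed. For integers $1\le d_0\le d$ let $$S=\mathrm{diag}\{i^{-a}\}_{i=1}^d,\qquad T=\mathrm{diag}\{\max\{i,d_0\}^{-(1+r)a}\}_{i=1}^d,\qquad W=\{w\in\mathbb R^d:\|w\|_2\le 1\},$$ and write $\|v\|_T^2=v^\top Tv$. Let $\mathcal P$ be the class of pairs $(P,Q)$ of a source law $P$ and a target law $Q$ of $(x,y)\in\mathbb R^d\times\mathbb R$ (with $y$ square integrable under both laws, $x$ having finite fourth moments under $P$ and finite second moments under $Q$) such that * $\mathbb E_P[xx^\top]=S$ and $\mathbb E_Q[xx^\top]=T$; * the source risk $\frac12\mathbb E_P(y-\langle w,x\rangle)^2$ and the target risk $\frac12\mathbb E_Q(y-\langle w,x\rangle)^2$ have a common minimizer $w^*$, and $w^*\in W$; * $\mathbb E_P[xx^\top Axx^\top]\preceq\psi\,\mathrm{tr}(SA)\,S$ for every positive semidefinite $A$; * $\mathbb E_P[\epsilon^2xx^\top]\preceq\sigma^2S$, where $\epsilon=y-\langle w^*,x\rangle$. Let $\mathcal P_0\subseteq\mathcal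 P$ consist of the pairs for which, in addition, the conditional law of $y$ given $x$ is the same under $P$ and under $Q$. Given $n$ i.i.d. samples $(x_t,y_t)$ from $P$, let $w_n^{\mathrm{SGD}}$ be the last iterate of one-pass SGD, $w_0=0$, $w_t=w_{t-1}-\eta_t(\langle x_t,w_{t-1}\rangle-y_t)x_t$, where $\eta_t$ starts at $\eta(n)$ and is divided by $4$ after every $K=\lfloor n/\lfloor\log_2n\rfloor\rfloor$ steps. Let $$R_n(\mathcal Q)=\inf_{\hat w}\sup_{(P,Q)\in\mathcal Q}\mathbb E\|\hat w-w^*\|_T^2$$ be the minimax risk, the infimum being over all randomized estimators based on $n$ i.i.d. samples from $P$. **Claim.** There are initial step sizes $\eta(n)>0$ depending only on $n,a,r,\sigma,\psi$, and constants $C,c>0$, $q\in\mathbb N$ depending only on $a,r,\sigma,\psi$, such that for all $1\le d_0\le d$ and all $n\ge 2$: 1. (upper bound) $$\sup_{(P,Q)\in\mathcal P}\mathbb E\|w_n^{\mathrm{SGD}}-w^*\|_T^2\le C(\ln n)^q\cdot\begin{cases}d_0^{-(1+r)a},&n\le d_0^{a+1},\\ n^{-\frac{(1+r)a}{1+a}},&n\ge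 d_0^{a+1}.\end{cases}$$ 2. (optimality up to logarithmic factors) If $\psi\ge3$, so that Gaussian covariates are admitted, then $$\sup_{(P,Q)\in\mathcal P}\mathbb E\|w_n^{\mathrm{SGD}}-w^*\|_T^2\le C(\ln n)^q\,R_n(\mathcal P_0).$$ 3. (plateau and drop) If $\psi\ge3$, then $R_n(\mathcal P_0)\ge c\,d_0^{-(1+r)a}$ for $n\le d_0^{a+1}$, and $R_n(\mathcal P_0)\ge c\,n^{-\frac{(1+r)a}{1+a}}$ for $d_0^{a+1}\le n\le d^{a+1}$. So, up to logarithmic factors, the worst-case risk of SGD stays at $d_0^{-(1+r)a}$ until $n\approx d_0^{a+1}$ and then decays like $n^{-(1+r)a/(1+a)}$ (as long as $n\le d^{a+1}$). -/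

import Mathlib

open MeasureTheory ProbabilityTheory Matrix

namespace CovShift

noncomputable section

/-- A labelled observation `(x, y)` with `x ∈ ℝ^d` and `y ∈ ℝ`. -/
abbrev Sample (d : ℕ) : Type := (Fin d → ℝ) × ℝ

/-- The squared elliptical (semi)norm `‖v‖_A² = vᵀ A v`. -/
def ellipNormSq {d : ℕ} (A : Matrix (Fin d) (Fin d) ℝ) (v : Fin d → ℝ) : ℝ :=
  v ⬝ᵥ (A *ᵥ v)

/-- The candidate set `W = {w : ‖w‖_M² ≤ 1}`. -/
def ellipsoid {d : ℕ} (M : Matrix (Fin d) (Fin d) ℝ) : Set (Fin d → ℝ) :=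
  {w | ellipNormSq M w ≤ 1}

/-- The second moment matrix `E[x xᵀ]` of the covariate. -/
def secondMoment {d : ℕ} (μ : Measure (Sample d)) : Matrix (Fin d) (Fin d) ℝ :=
  Matrix.of fun i j => ∫ z, z.1 i * z.1 j ∂μ

/-- The matrix `E[x xᵀ A x xᵀ]`. -/
def fourthMoment {d : ℕ} (μ : Measure (Sample d)) (A : Matrix (Fin d) (Fin d) ℝ) :
    Matrix (Fin d) (Fin d) ℝ :=
  Matrix.of fun i j => ∫ z, (z.1 ⬝ᵥ (A *ᵥ z.1)) * (z.1 i * z.1 j) ∂μ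

/-- The matrix `E[ε² x xᵀ]`, where `ε = y - ⟨w, x⟩`. -/
def noiseMoment {d : ℕ} (μ : Measure (Sample d)) (w : Fin d → ℝ) :
    Matrix (Fin d) (Fin d) ℝ :=
  Matrix.of fun i j => ∫ z, (z.2 - w ⬝ᵥ z.1) ^ 2 * (z.1 i * z.1 j) ∂μ

/-- The risk `½ E (y - ⟨w, x⟩)²` of the regressor `w`. -/
def sqRisk {d : ℕ} (μ : Measure (Sample d)) (w : Fin d → ℝ) : ℝ :=
  (1 / 2) * ∫ z, (z.2 - w ⬝ᵥ z.1) ^ 2 ∂μ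

/-- `(P, Q)` is a source/target pair of laws of `(x, y)` with best regressor `w`, belonging to the
problem class with candidate set `W`, source covariance `S`, target covariance `T`, noise level
`σ²` and fourth-moment constant `ψ`. The integrability fields say that all the moments that occur
are finite. -/
structure IsProblem {d : ℕ} (W : Set (Fin d → ℝ)) (S T : Matrix (Fin d) (Fin d) ℝ) (σ ψ : ℝ)
    (P Q : Measure (Sample d)) (w : Fin d → ℝ) : Prop where
  prob_source : IsProbabilityMeasure P
  prob_target : IsProbabilityMeasure Q
  memLp_x_source : ∀ i, MemLp (fun z : Sample d => z.1 i) 4 P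
  memLp_x_target : ∀ i, MemLp (fun z : Sample d => z.1 i) 2 Q
  memLp_y_source : MemLp (fun z : Sample d => z.2) 2 P
  memLp_y_target : MemLp (fun z : Sample d => z.2) 2 Q
  cov_source : secondMoment P = S
  cov_target : secondMoment Q = T
  /-- `w` minimizes both the source risk and the target risk. -/
  minimizer_source : ∀ v, sqRisk P w ≤ sqRisk P v
  minimizer_target : ∀ v, sqRisk Q w ≤ sqRisk Q v
  mem_candidates : w ∈ W
  /-- `E[x xᵀ A x xᵀ] ≼ ψ tr(S A) S` for every positive semidefinite `A`. -/
  fourth_moment : ∀ A : Matrix (Fin d) (Fin d) ℝ, A.PosSemidef →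
    ((ψ * (S * A).trace) • S - fourthMoment P A).PosSemidef
  /-- `E[ε² x xᵀ] ≼ σ² S`. -/
  noise_integrable : ∀ i j, Integrable
    (fun z : Sample d => (z.2 - w ⬝ᵥ z.1) ^ 2 * (z.1 i * z.1 j)) P
  noise_bound : (σ ^ 2 • S - noiseMoment P w).PosSemidef

/-- The problem class, as the set of all triples `(P, Q, w)` of a source law, a target law and
their best regressor. -/
def problemClass {d : ℕ} (W : Set (Fin d → ℝ)) (S T : Matrix (Fin d) (Fin d) ℝ) (σ ψ : ℝ) :
    Set (Measure (Sample d) × Measure (Sample d) × (Fin d → ℝ)) :=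
  {p | IsProblem W S T σ ψ p.1 p.2.1 p.2.2}

/-- The problems of the class for which, moreover, the conditional law of `y` given `x` (the
Markov kernel `κ`) is the same in the source and in the target domain. -/
def covariateShiftClass {d : ℕ} (W : Set (Fin d → ℝ)) (S T : Matrix (Fin d) (Fin d) ℝ) (σ ψ : ℝ) :
    Set (Measure (Sample d) × Measure (Sample d) × (Fin d → ℝ)) :=
  {p | p ∈ problemClass W S T σ ψ ∧ ∃ κ : Kernel (Fin d → ℝ) ℝ, IsMarkovKernel κ ∧
    p.1 = (p.1.map Prod.fst) ⊗ₘ κ ∧ p.2.1 = (p.2.1.map Prod.fst) ⊗ₘ κ}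

/-- The expected excess target risk `E ‖ŵ - w‖_T²` of the randomized estimator `ŵ(data, ξ)`, when
the data are `n` independent observations with law `P` and `ξ` is independent with law `ν`. -/
def estimatorRisk {d : ℕ} (n : ℕ) (T : Matrix (Fin d) (Fin d) ℝ) (P : Measure (Sample d))
    (w : Fin d → ℝ) {Ξ : Type} [MeasurableSpace Ξ] (ν : Measure Ξ)
    (est : (Fin n → Sample d) → Ξ → (Fin d → ℝ)) : ENNReal :=
  ∫⁻ s, ENNReal.ofReal (ellipNormSq T (est s.1 s.2 - w))
    ∂((Measure.pi fun _ : Fin n => P).prod ν)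

/-- The minimax risk over the class `𝒬`: infimum over all randomized estimators `ŵ(data, ξ)` of the
worst-case risk. -/
def minimaxRisk {d : ℕ} (n : ℕ) (T : Matrix (Fin d) (Fin d) ℝ)
    (𝒬 : Set (Measure (Sample d) × Measure (Sample d) × (Fin d → ℝ))) : ENNReal :=
  ⨅ (Ξ : Type) (_ : MeasurableSpace Ξ) (ν : Measure Ξ) (_ : IsProbabilityMeasure ν)
    (est : (Fin n → Sample d) → Ξ → (Fin d → ℝ))
    (_ : Measurable fun s : (Fin n → Sample d) × Ξ => est s.1 s.2),
    ⨆ p ∈ 𝒬, estimatorRisk n T p.1 p.2.2 ν est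

/-- The geometrically decaying schedule: there are `log₂ n` phases of `K = n / log₂ n` steps each
(both rounded down), and the step size, initially `η`, is divided by `4` after each phase. Steps are
numbered from `t = 0`; the few steps that rounding leaves over continue the pattern. -/
def stepSize (η : ℝ) (n t : ℕ) : ℝ :=
  η / 4 ^ (t / (n / Nat.log 2 n))

/-- The iterates `w_t` of one-pass stochastic gradient descent on the data `z`, started at `0`:
`w_{t+1} = w_t - η_t (⟨x_{t+1}, w_t⟩ - y_{t+1}) x_{t+1}`. -/
def sgdIterate {d n : ℕ} (η : ℝ) (z : Fin n → Sample d) : ℕ → (Fin d → ℝ)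
  | 0 => 0
  | t + 1 =>
    if h : t < n then
      sgdIterate η z t -
        (stepSize η n t * ((z ⟨t, h⟩).1 ⬝ᵥ sgdIterate η z t - (z ⟨t, h⟩).2)) • (z ⟨t, h⟩).1
    else sgdIterate η z t

/-- The expected excess target risk `E ‖w_n - w‖_T²` of the last iterate of stochastic gradient
descent with initial step size `η`, on `n` independent observations with law `P`. -/
def sgdRisk {d : ℕ} (n : ℕ) (η : ℝ) (T : Matrix (Fin d) (Fin d) ℝ) (P : Measure (Sample d))
    (w : Fin d → ℝ) : ENNReal :=
  ∫⁻ z, ENNReal.ofReal (ellipNormSq T (sgdIterate η z n - w)) ∂(Measure.pi fun _ : Fin n => P)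

/-- `S = diag(i^{-a})`, `i = 1, …, d`. -/
def sourceCov (a : ℝ) (d : ℕ) : Matrix (Fin d) (Fin d) ℝ :=
  Matrix.diagonal fun i => ((i : ℝ) + 1) ^ (-a)

/-- `T = diag(max{i, d₀}^{-(1+r)a})`, `i = 1, …, d`. -/
def targetCov (a r : ℝ) (d₀ d : ℕ) : Matrix (Fin d) (Fin d) ℝ :=
  Matrix.diagonal fun i => (max ((i : ℝ) + 1) (d₀ : ℝ)) ^ (-((1 + r) * a))

end

end CovShift

/-! Upper bound. Both covariances are diagonal, so the risk is a weighted sum of the coordinatewise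
second moments of `w_t - w`. One step of SGD shrinks the moment of coordinate i by the factor 1 -
2γλ_i and adds at most 2γ²λ_i(ψ Σ_j λ_j m_j + σ²). Under the trace condition ηψ tr S ≤ 1/2 the
feedback Σ_j λ_j m_j stays bounded, and the recursion decouples into a bias that decays
exponentially and a variance driven by constant noise (`errorBound_stepSize_le`).

Put N = n^(1/(1+a)), so that N^(a+1) = n, and take η of order 1/N. Up to logarithms, coordinate i is
learned exactly when i ≤ N: the bias factor is at most a power of i/N, and the variance is at most
i^a/n below N and (n/N²) i^(-a) above it. The two variance bounds meet at i = N with value 1/N.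
Summing against i^(-θ) gives N^(-θ) up to logarithms whenever 0 ≤ θ ≤ a + 1; the value θ = (1+r)a is
admissible because r < 1/a. The value θ = 0 gives the plateau, since the target spectrum never
exceeds d₀^(-(1+r)a).

Lower bound. Assouad's method is applied to regressors (±b_i) with b_i² = (c/n) i^a for i ≤ D, where
D^(a+1) ≤ n. This is the largest amplitude, up to constants, at which n samples do not reveal the
signs, and the condition on D keeps the vertices in the unit ball. Rademacher covariates with
two-point responses lie in the class once ψ ≥ 3 and make all likelihoods finite sums. The bound is
of order Σ_{i ≤ D} τ_i i^a / n (`exists_parametric_le_minimaxRisk`). With D = ⌊N⌋ it is the rate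
max(N, d₀)^(-(1+r)a).

For n ≥ d^(a+1) the minimax risk may be below this rate. There D = d, and SGD is compared with the
same expression through a second upper bound (`exists_sum_errorBound_le_parametric`). -/

namespace CovShift

noncomputable section

section

/-! ### The moments of stochastic gradient descent -/

variable {d n : ℕ}

/-- One step of stochastic gradient descent with step size `γ`. -/
def sgdStep (γ : ℝ) (v : Fin d → ℝ) (z : Sample d) : Fin d → ℝ :=
  v - (γ * (z.1 ⬝ᵥ v - z.2)) • z.1

lemma measurable_sgdStep (γ : ℝ) :
    Measurable fun p : (Fin d → ℝ) × Sample d => sgdStep γ p.1 p.2 := by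
  refine Continuous.measurable ?_
  unfold sgdStep dotProduct
  fun_prop

lemma sgdIterate_succ (η : ℝ) (z : Fin n → Sample d) {t : ℕ} (h : t < n) :
    sgdIterate η z (t + 1) = sgdStep (stepSize η n t) (sgdIterate η z t) (z ⟨t, h⟩) := by
  simp [sgdIterate, sgdStep, h]

lemma measurable_sgdIterate (η : ℝ) (t : ℕ) :
    Measurable fun z : Fin n → Sample d => sgdIterate η z t := by
  induction t with
  | zero => exact measurable_const
  | succ t ih =>
    by_cases h : t < n
    · simp_rw [sgdIterate_succ η _ h]
      exact (measurable_sgdStep _).comp (ih.prodMk (measurable_pi_apply _))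
    · simpa [sgdIterate, h] using ih

lemma sgdIterate_congr (η : ℝ) {z z' : Fin n → Sample d} (t : ℕ)
    (h : ∀ i : Fin n, (i : ℕ) < t → z i = z' i) : sgdIterate η z t = sgdIterate η z' t := by
  induction t with
  | zero => rfl
  | succ t ih =>
    have ih' := ih fun i hi => h i (by omega)
    by_cases ht : t < n
    · rw [sgdIterate_succ _ _ ht, sgdIterate_succ _ _ ht, ih', h ⟨t, ht⟩ (by simp)]
    · simpa [sgdIterate, ht] using ih'

/-- The iterate w_t is a function of the samples with index below t, hence independent of the sample
used in the next step. -/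
lemma map_sgdIterate_prod (P : Measure (Sample d)) [IsProbabilityMeasure P] (η : ℝ) {t : ℕ}
    (ht : t < n) :
    (Measure.pi fun _ : Fin n => P).map (fun z => (sgdIterate η z t, z ⟨t, ht⟩)) =
      ((Measure.pi fun _ : Fin n => P).map fun z => sgdIterate η z t).prod P := by
  have hind : iIndepFun (fun (i : Fin n) (z : Fin n → Sample d) => z i)
      (Measure.pi fun _ : Fin n => P) :=
    iIndepFun_pi (X := fun _ x => x) fun _ => aemeasurable_id
  let A : Finset (Fin n) := Finset.univ.filter fun i => (i : ℕ) < t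
  have hdisj : Disjoint A {⟨t, ht⟩} := by simp [A]
  have h2 := hind.indepFun_finset A {⟨t, ht⟩} hdisj fun i => measurable_pi_apply i
  -- Samples outside `A` are filled in with 0; by `sgdIterate_congr` their values do not matter.
  let φ : (A → Sample d) → (Fin d → ℝ) := fun y =>
    sgdIterate η (fun i => if h : i ∈ A then y ⟨i, h⟩ else 0) t
  have hφ : Measurable φ := by
    refine (measurable_sgdIterate η t).comp (measurable_pi_iff.2 fun i => ?_)
    by_cases h : i ∈ A
    · simpa [h] using measurable_pi_apply _
    · simp [h]
  let χ : (({⟨t, ht⟩} : Finset (Fin n)) → Sample d) → Sample d := fun y => y ⟨⟨t, ht⟩, by simp⟩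
  have hχ : Measurable χ := measurable_pi_apply _
  have h3 := h2.comp hφ hχ
  have e1 : (φ ∘ fun (z : Fin n → Sample d) (i : A) => z i) = fun z => sgdIterate η z t := by
    funext z
    refine sgdIterate_congr η t fun i hi => ?_
    simp [A, hi]
  have e2 : (χ ∘ fun (z : Fin n → Sample d) (i : ({⟨t, ht⟩} : Finset (Fin n))) => z i) =
      fun z => z ⟨t, ht⟩ := rfl
  rw [e1, e2, indepFun_iff_map_prod_eq_prod_map_map (measurable_sgdIterate η t).aemeasurable
    (measurable_pi_apply _).aemeasurable] at h3
  rw [h3, (measurePreserving_eval (fun _ : Fin n => P) ⟨t, ht⟩).map_eq]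

namespace IsProblem

variable {W : Set (Fin d → ℝ)} {S T : Matrix (Fin d) (Fin d) ℝ} {σ ψ : ℝ}
  {P Q : Measure (Sample d)} {w : Fin d → ℝ}

lemma memLp_two (h : IsProblem W S T σ ψ P Q w) (i : Fin d) :
    MemLp (fun z : Sample d => z.1 i) 2 P :=
  have := h.prob_source
  (h.memLp_x_source i).mono_exponent (by norm_num)

lemma memLp_dotProduct (h : IsProblem W S T σ ψ P Q w) (v : Fin d → ℝ) :
    MemLp (fun z : Sample d => v ⬝ᵥ z.1) 4 P := by
  unfold dotProduct
  exact memLp_finsetSum _ fun i _ => (h.memLp_x_source i).const_mul _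

lemma memLp_residual (h : IsProblem W S T σ ψ P Q w) (v : Fin d → ℝ) :
    MemLp (fun z : Sample d => z.2 - v ⬝ᵥ z.1) 2 P :=
  have := h.prob_source
  h.memLp_y_source.sub ((h.memLp_dotProduct v).mono_exponent (by norm_num))

/-- First-order optimality of w for the source risk, in the direction of the i-th basis vector. -/
lemma integral_residual_mul (h : IsProblem W S T σ ψ P Q w) (i : Fin d) :
    ∫ z, (z.2 - w ⬝ᵥ z.1) * z.1 i ∂P = 0 := by
  have hε := h.memLp_residual w
  have hx := h.memLp_two i
  have i1 : Integrable (fun z : Sample d => (z.2 - w ⬝ᵥ z.1) ^ 2) P := hε.integrable_sq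
  have i2 : Integrable (fun z : Sample d => (z.2 - w ⬝ᵥ z.1) * z.1 i) P := hε.integrable_mul hx
  have i3 : Integrable (fun z : Sample d => (z.1 i) ^ 2) P := hx.integrable_sq
  set b := ∫ z, (z.2 - w ⬝ᵥ z.1) * z.1 i ∂P with hb
  set c := ∫ z, (z.1 i) ^ 2 ∂P with hc
  have hc0 : 0 ≤ c := integral_nonneg fun z => sq_nonneg _
  have key : ∀ t : ℝ, 0 ≤ -2 * t * b + t ^ 2 * c := by
    intro t
    have hm := h.minimizer_source (w + t • Pi.single i 1)
    unfold sqRisk at hm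
    have e : ∀ z : Sample d, (z.2 - (w + t • Pi.single i 1) ⬝ᵥ z.1) ^ 2 =
        (z.2 - w ⬝ᵥ z.1) ^ 2 + (-2 * t) * ((z.2 - w ⬝ᵥ z.1) * z.1 i) + t ^ 2 * (z.1 i) ^ 2 := by
      intro z
      rw [add_dotProduct, smul_dotProduct, single_dotProduct]
      simp only [smul_eq_mul]
      ring
    simp_rw [e] at hm
    have i12 : Integrable (fun z : Sample d => (z.2 - w ⬝ᵥ z.1) ^ 2 +
        (-2 * t) * ((z.2 - w ⬝ᵥ z.1) * z.1 i)) P := i1.add (i2.const_mul _)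
    rw [integral_add i12 (i3.const_mul _), integral_add i1 (i2.const_mul _),
      integral_const_mul, integral_const_mul] at hm
    linarith
  -- The optimal step would be b / c; the denominator c + 1 also covers a coordinate that vanishes
  -- almost surely.
  have h1 := key (b / (c + 1))
  have hc1 : 0 < c + 1 := by linarith
  have e : -2 * (b / (c + 1)) * b + (b / (c + 1)) ^ 2 * c =
      -(b ^ 2 * (c + 2)) / (c + 1) ^ 2 := by
    field_simp
    ring
  rw [e] at h1
  have h2 : 0 ≤ -(b ^ 2 * (c + 2)) := by
    by_contra hneg
    exact absurd h1 (not_le.2 (div_neg_of_neg_of_pos (not_le.1 hneg) (by positivity)))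
  nlinarith [sq_nonneg b, mul_nonneg (sq_nonneg b) hc0]

variable {lam : Fin d → ℝ}

lemma integral_mul (h : IsProblem W (diagonal lam) T σ ψ P Q w) (i j : Fin d) :
    ∫ z, z.1 i * z.1 j ∂P = diagonal lam i j := by
  rw [← h.cov_source]
  rfl

lemma integral_noise_le (h : IsProblem W (diagonal lam) T σ ψ P Q w) (i : Fin d) :
    ∫ z, (z.2 - w ⬝ᵥ z.1) ^ 2 * (z.1 i * z.1 i) ∂P ≤ σ ^ 2 * lam i := by
  have := h.noise_bound.diag_nonneg (i := i)
  simp only [noiseMoment, Matrix.sub_apply, Matrix.smul_apply, diagonal_apply_eq, of_apply,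
    smul_eq_mul] at this
  linarith

/-- The fourth-moment condition is tested on the rank-one matrix A = u uᵀ and read off at a diagonal
entry. -/
lemma integral_fourth_le (h : IsProblem W (diagonal lam) T σ ψ P Q w) (i : Fin d)
    (u : Fin d → ℝ) :
    ∫ z, (u ⬝ᵥ z.1) ^ 2 * (z.1 i * z.1 i) ∂P ≤ ψ * (∑ j, lam j * u j ^ 2) * lam i := by
  have hA : (vecMulVec u u).PosSemidef := by
    simpa using posSemidef_vecMulVec_self_star u
  have := (h.fourth_moment _ hA).diag_nonneg (i := i)
  simp only [fourthMoment, Matrix.sub_apply, Matrix.smul_apply, diagonal_apply_eq, of_apply,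
    smul_eq_mul] at this
  have e : ∀ x : Fin d → ℝ, x ⬝ᵥ (vecMulVec u u *ᵥ x) = (u ⬝ᵥ x) ^ 2 := by
    intro x
    rw [vecMulVec_mulVec, dotProduct_smul, dotProduct_comm x u]
    simp [sq]
  have e' : (diagonal lam * vecMulVec u u).trace = ∑ j, lam j * u j ^ 2 := by
    simp [Matrix.trace, diagonal_mul, vecMulVec_apply, sq]
  simp_rw [e, e'] at this
  linarith

/-- With u = v - w the new error is u_i - γ(⟨u,x⟩ - ε)x_i. The term linear in ε vanishes by
`integral_residual_mul`. As ε may depend on x, the mixed quadratic term need not vanish; (⟨u,x⟩ -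
ε)² ≤ 2⟨u,x⟩² + 2ε² removes it at the price of a factor 2. Since S is diagonal, only squares of
coordinates remain and the recursion closes. -/
lemma lintegral_sgdStep_le (h : IsProblem W (diagonal lam) T σ ψ P Q w) (γ : ℝ) (i : Fin d)
    (v : Fin d → ℝ) :
    ∫⁻ z, ENNReal.ofReal ((sgdStep γ v z i - w i) ^ 2) ∂P ≤
      ENNReal.ofReal ((1 - 2 * γ * lam i) * (v i - w i) ^ 2 +
        2 * γ ^ 2 * lam i * (ψ * ∑ j, lam j * (v j - w j) ^ 2 + σ ^ 2)) := by
  have := h.prob_source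
  set u : Fin d → ℝ := v - w with hu
  have i1 : Integrable (fun z : Sample d => (u ⬝ᵥ z.1) * z.1 i) P :=
    ((h.memLp_dotProduct u).mono_exponent (by norm_num : (2 : ENNReal) ≤ 4)).integrable_mul
      (h.memLp_two i)
  have i2 : Integrable (fun z : Sample d => (z.2 - w ⬝ᵥ z.1) * z.1 i) P :=
    (h.memLp_residual w).integrable_mul (h.memLp_two i)
  have i3 : Integrable (fun z : Sample d => (u ⬝ᵥ z.1) ^ 2 * (z.1 i * z.1 i)) P := by
    have : ENNReal.HolderTriple 4 4 2 := ⟨by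
      rw [← two_mul, show (4 : ENNReal) = 2 * 2 by norm_num, ENNReal.mul_inv (by simp) (by simp),
        ← mul_assoc, ENNReal.mul_inv_cancel (by simp) (by simp), one_mul]⟩
    have h4 : MemLp (fun z : Sample d => (u ⬝ᵥ z.1) * z.1 i) 2 P :=
      (h.memLp_x_source i).mul (h.memLp_dotProduct u)
    refine h4.integrable_sq.congr (Filter.Eventually.of_forall fun z => ?_)
    simp only
    ring
  have i4 := h.noise_integrable i i
  let g : Sample d → ℝ := fun z => u i ^ 2 +
    (-(2 * γ * u i) * ((u ⬝ᵥ z.1) * z.1 i) + (2 * γ * u i) * ((z.2 - w ⬝ᵥ z.1) * z.1 i) +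
    (2 * γ ^ 2 * ((u ⬝ᵥ z.1) ^ 2 * (z.1 i * z.1 i)) +
      2 * γ ^ 2 * ((z.2 - w ⬝ᵥ z.1) ^ 2 * (z.1 i * z.1 i))))
  have hfg : ∀ z : Sample d, (sgdStep γ v z i - w i) ^ 2 ≤ g z := by
    intro z
    have e : sgdStep γ v z i - w i =
        u i - γ * ((u ⬝ᵥ z.1) - (z.2 - w ⬝ᵥ z.1)) * z.1 i := by
      simp only [sgdStep, hu, sub_dotProduct, Pi.sub_apply, Pi.smul_apply, smul_eq_mul,
        dotProduct_comm z.1 v]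
      ring
    rw [e]
    simp only [g]
    nlinarith [sq_nonneg (γ * ((u ⬝ᵥ z.1) + (z.2 - w ⬝ᵥ z.1)) * z.1 i)]
  have ia := (i1.const_mul (-(2 * γ * u i))).add (i2.const_mul (2 * γ * u i))
  have ib := (i3.const_mul (2 * γ ^ 2)).add (i4.const_mul (2 * γ ^ 2))
  have ig : Integrable g P := (integrable_const _).add (ia.add ib)
  have e1 : ∫ z, (u ⬝ᵥ z.1) * z.1 i ∂P = lam i * u i := by
    have : ∀ z : Sample d, (u ⬝ᵥ z.1) * z.1 i = ∑ j, u j * (z.1 j * z.1 i) := by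
      intro z
      rw [dotProduct, Finset.sum_mul]
      exact Finset.sum_congr rfl fun j _ => by ring
    simp_rw [this]
    have ij : ∀ j, Integrable (fun z : Sample d => z.1 j * z.1 i) P := fun j =>
      (h.memLp_two j).integrable_mul (h.memLp_two i)
    rw [integral_finsetSum _ fun j _ => (ij j).const_mul (u j)]
    simp_rw [integral_const_mul, h.integral_mul, diagonal_apply]
    simp [mul_comm]
  have eg : ∫ z, g z ∂P = u i ^ 2 + (-(2 * γ * u i) * (lam i * u i) + (2 * γ * u i) * 0 +
      (2 * γ ^ 2 * ∫ z, (u ⬝ᵥ z.1) ^ 2 * (z.1 i * z.1 i) ∂P +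
        2 * γ ^ 2 * ∫ z, (z.2 - w ⬝ᵥ z.1) ^ 2 * (z.1 i * z.1 i) ∂P)) := by
    simp only [g]
    erw [integral_add (integrable_const _) (ia.add ib), integral_add ia ib,
      integral_add (i1.const_mul _) (i2.const_mul _),
      integral_add (i3.const_mul _) (i4.const_mul _)]
    simp_rw [integral_const_mul]
    rw [e1, h.integral_residual_mul i]
    simp
  calc ∫⁻ z, ENNReal.ofReal ((sgdStep γ v z i - w i) ^ 2) ∂P
      ≤ ∫⁻ z, ENNReal.ofReal (g z) ∂P :=
        lintegral_mono fun z => ENNReal.ofReal_le_ofReal (hfg z)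
    _ = ENNReal.ofReal (∫ z, g z ∂P) :=
        (ofReal_integral_eq_lintegral_ofReal ig (Filter.Eventually.of_forall fun z =>
          (sq_nonneg _).trans (hfg z))).symm
    _ ≤ _ := by
        refine ENNReal.ofReal_le_ofReal ?_
        rw [eg]
        have h4 := mul_le_mul_of_nonneg_left (h.integral_fourth_le i u) (sq_nonneg γ)
        have h5 := mul_le_mul_of_nonneg_left (h.integral_noise_le i) (sq_nonneg γ)
        have : ∀ j, v j - w j = u j := fun j => rfl
        simp_rw [this]
        linarith

end IsProblem

/-- The recursion that dominates the coordinatewise second moments of the error of stochastic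
gradient descent with step sizes `γ`. -/
def errorBound (lam : Fin d → ℝ) (σ ψ : ℝ) (γ : ℕ → ℝ) (m₀ : Fin d → ℝ) : ℕ → Fin d → ℝ
  | 0 => m₀
  | t + 1 => fun i => (1 - 2 * γ t * lam i) * errorBound lam σ ψ γ m₀ t i +
      2 * γ t ^ 2 * lam i * (ψ * ∑ j, lam j * errorBound lam σ ψ γ m₀ t j + σ ^ 2)

lemma errorBound_nonneg {lam : Fin d → ℝ} {σ ψ : ℝ} {γ : ℕ → ℝ} {m₀ : Fin d → ℝ}
    (hlam : ∀ i, 0 ≤ lam i) (hψ : 0 ≤ ψ) (hγ : ∀ t i, 2 * γ t * lam i ≤ 1)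
    (hm : ∀ i, 0 ≤ m₀ i) (t : ℕ) (i : Fin d) : 0 ≤ errorBound lam σ ψ γ m₀ t i := by
  induction t generalizing i with
  | zero => exact hm i
  | succ t ih =>
    have h1 : 0 ≤ ∑ j, lam j * errorBound lam σ ψ γ m₀ t j :=
      Finset.sum_nonneg fun j _ => mul_nonneg (hlam j) (ih j)
    have h2 := hlam i
    have h3 : 0 ≤ 1 - 2 * γ t * lam i := by linarith [hγ t i]
    exact add_nonneg (mul_nonneg h3 (ih i)) (by positivity)

/-- Working with lower integrals avoids carrying integrability of the iterates through the
induction. -/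
lemma lintegral_sgdIterate_le {W : Set (Fin d → ℝ)} {T : Matrix (Fin d) (Fin d) ℝ} {σ ψ : ℝ}
    {P Q : Measure (Sample d)} {w lam : Fin d → ℝ}
    (h : IsProblem W (diagonal lam) T σ ψ P Q w) {η : ℝ} (hlam : ∀ i, 0 ≤ lam i) (hψ : 0 ≤ ψ)
    (hγ : ∀ t i, 2 * stepSize η n t * lam i ≤ 1) {t : ℕ} (ht : t ≤ n) (i : Fin d) :
    ∫⁻ z, ENNReal.ofReal ((sgdIterate η z t i - w i) ^ 2) ∂(Measure.pi fun _ : Fin n => P) ≤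
      ENNReal.ofReal (errorBound lam σ ψ (stepSize η n) (fun i => w i ^ 2) t i) := by
  have := h.prob_source
  induction t generalizing i with
  | zero => simp [sgdIterate, errorBound]
  | succ t ih =>
    have htn : t < n := ht
    set γ := stepSize η n t with hγt
    set m := errorBound lam σ ψ (stepSize η n) (fun i => w i ^ 2) t with hm
    have hm0 : ∀ j, 0 ≤ m j := errorBound_nonneg hlam hψ hγ (fun j => sq_nonneg _) t
    have hmeas := measurable_sgdIterate (d := d) (n := n) η t
    let f : (Fin d → ℝ) × Sample d → ENNReal := fun p =>
      ENNReal.ofReal ((sgdStep γ p.1 p.2 i - w i) ^ 2)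
    have hf : Measurable f :=
      ((((measurable_pi_apply i).comp (measurable_sgdStep γ)).sub_const _).pow_const 2).ennreal_ofReal
    have e1 : ∫⁻ z, ENNReal.ofReal ((sgdIterate η z (t + 1) i - w i) ^ 2)
        ∂(Measure.pi fun _ : Fin n => P) =
        ∫⁻ z, f (sgdIterate η z t, z ⟨t, htn⟩) ∂(Measure.pi fun _ : Fin n => P) := by
      simp_rw [sgdIterate_succ η _ htn]
      rfl
    have e2 : ∫⁻ z, f (sgdIterate η z t, z ⟨t, htn⟩) ∂(Measure.pi fun _ : Fin n => P) =
        ∫⁻ z, ∫⁻ s, f (sgdIterate η z t, s) ∂P ∂(Measure.pi fun _ : Fin n => P) := by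
      rw [← lintegral_map (f := f) hf (hmeas.prodMk (measurable_pi_apply _)),
        map_sgdIterate_prod P η htn, lintegral_prod _ hf.aemeasurable,
        lintegral_map hf.lintegral_prod_right' hmeas]
    have hc1 : 0 ≤ 1 - 2 * γ * lam i := by linarith [hγ t i]
    have hc2 : ∀ j, 0 ≤ 2 * γ ^ 2 * lam i * (ψ * lam j) := fun j => by
      have := hlam i; have := hlam j; positivity
    have hc3 : 0 ≤ 2 * γ ^ 2 * lam i * σ ^ 2 := by have := hlam i; positivity
    -- The one-step bound is affine in the moments with nonnegative coefficients (this needs 2γλ_i ≤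
    -- 1), so it commutes with the outer integral and is monotone in the induction hypothesis.
    have expand : ∀ y : Fin d → ℝ, (∀ j, 0 ≤ y j) →
        ENNReal.ofReal ((1 - 2 * γ * lam i) * y i +
          2 * γ ^ 2 * lam i * (ψ * ∑ j, lam j * y j + σ ^ 2)) =
        ENNReal.ofReal (1 - 2 * γ * lam i) * ENNReal.ofReal (y i) +
          (∑ j, ENNReal.ofReal (2 * γ ^ 2 * lam i * (ψ * lam j)) * ENNReal.ofReal (y j) +
            ENNReal.ofReal (2 * γ ^ 2 * lam i * σ ^ 2)) := by
      intro y hy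
      have : (1 - 2 * γ * lam i) * y i +
          2 * γ ^ 2 * lam i * (ψ * ∑ j, lam j * y j + σ ^ 2) = (1 - 2 * γ * lam i) * y i +
          (∑ j, 2 * γ ^ 2 * lam i * (ψ * lam j) * y j + 2 * γ ^ 2 * lam i * σ ^ 2) := by
        rw [mul_add, ← mul_assoc, Finset.mul_sum]
        congr 2
        exact Finset.sum_congr rfl fun j _ => by ring
      rw [this, ENNReal.ofReal_add (mul_nonneg hc1 (hy i))
        (add_nonneg (Finset.sum_nonneg fun j _ => mul_nonneg (hc2 j) (hy j)) hc3),
        ENNReal.ofReal_add (Finset.sum_nonneg fun j _ => mul_nonneg (hc2 j) (hy j)) hc3,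
        ENNReal.ofReal_mul hc1, ENNReal.ofReal_sum_of_nonneg
          fun j _ => mul_nonneg (hc2 j) (hy j)]
      simp_rw [ENNReal.ofReal_mul (hc2 _)]
    have hmj : ∀ j, Measurable fun z : Fin n → Sample d =>
        ENNReal.ofReal ((sgdIterate η z t j - w j) ^ 2) := fun j =>
      ((((measurable_pi_apply j).comp hmeas).sub_const _).pow_const 2).ennreal_ofReal
    rw [e1, e2]
    calc ∫⁻ z, ∫⁻ s, f (sgdIterate η z t, s) ∂P ∂(Measure.pi fun _ : Fin n => P)
        ≤ ∫⁻ z, (ENNReal.ofReal (1 - 2 * γ * lam i) *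
            ENNReal.ofReal ((sgdIterate η z t i - w i) ^ 2) +
          (∑ j, ENNReal.ofReal (2 * γ ^ 2 * lam i * (ψ * lam j)) *
            ENNReal.ofReal ((sgdIterate η z t j - w j) ^ 2) +
            ENNReal.ofReal (2 * γ ^ 2 * lam i * σ ^ 2))) ∂(Measure.pi fun _ : Fin n => P) :=
          lintegral_mono fun z => (h.lintegral_sgdStep_le γ i _).trans_eq
            (expand (fun j => (sgdIterate η z t j - w j) ^ 2) fun j => sq_nonneg _)
      _ = ENNReal.ofReal (1 - 2 * γ * lam i) * (∫⁻ z,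
            ENNReal.ofReal ((sgdIterate η z t i - w i) ^ 2) ∂(Measure.pi fun _ : Fin n => P)) +
          (∑ j, ENNReal.ofReal (2 * γ ^ 2 * lam i * (ψ * lam j)) * (∫⁻ z,
            ENNReal.ofReal ((sgdIterate η z t j - w j) ^ 2) ∂(Measure.pi fun _ : Fin n => P)) +
            ENNReal.ofReal (2 * γ ^ 2 * lam i * σ ^ 2)) := by
          rw [lintegral_add_left ((hmj i).const_mul _), lintegral_const_mul _ (hmj i),
            lintegral_add_right _ measurable_const,
            lintegral_finsetSum _ fun j _ => (hmj j).const_mul _]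
          simp_rw [lintegral_const_mul _ (hmj _)]
          simp
      _ ≤ ENNReal.ofReal (1 - 2 * γ * lam i) * ENNReal.ofReal (m i) +
          (∑ j, ENNReal.ofReal (2 * γ ^ 2 * lam i * (ψ * lam j)) * ENNReal.ofReal (m j) +
            ENNReal.ofReal (2 * γ ^ 2 * lam i * σ ^ 2)) := by
          gcongr with j
          · exact ih htn.le i
          · exact ih htn.le j
      _ = _ := (expand m hm0).symm

lemma sgdRisk_le_errorBound {W : Set (Fin d → ℝ)} {σ ψ : ℝ} {P Q : Measure (Sample d)}
    {w lam tau : Fin d → ℝ} (h : IsProblem W (diagonal lam) (diagonal tau) σ ψ P Q w) {η : ℝ}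
    (hlam : ∀ i, 0 ≤ lam i) (htau : ∀ i, 0 ≤ tau i) (hψ : 0 ≤ ψ)
    (hγ : ∀ t i, 2 * stepSize η n t * lam i ≤ 1) :
    sgdRisk n η (diagonal tau) P w ≤ ENNReal.ofReal
      (∑ i, tau i * errorBound lam σ ψ (stepSize η n) (fun i => w i ^ 2) n i) := by
  have hm0 := errorBound_nonneg (σ := σ) (m₀ := fun i => w i ^ 2) hlam hψ hγ
    (fun j => sq_nonneg _) n
  have hmeas := measurable_sgdIterate (d := d) (n := n) η n
  have hmj : ∀ j, Measurable fun z : Fin n → Sample d =>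
      ENNReal.ofReal ((sgdIterate η z n j - w j) ^ 2) := fun j =>
    ((((measurable_pi_apply j).comp hmeas).sub_const _).pow_const 2).ennreal_ofReal
  have e : ∀ v : Fin d → ℝ, ENNReal.ofReal (ellipNormSq (diagonal tau) (v - w)) =
      ∑ i, ENNReal.ofReal (tau i) * ENNReal.ofReal ((v i - w i) ^ 2) := by
    intro v
    simp_rw [← ENNReal.ofReal_mul (htau _)]
    rw [← ENNReal.ofReal_sum_of_nonneg fun i _ => mul_nonneg (htau i) (sq_nonneg _)]
    congr 1
    simp only [ellipNormSq, mulVec_diagonal, dotProduct, Pi.sub_apply]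
    exact Finset.sum_congr rfl fun i _ => by ring
  unfold sgdRisk
  simp_rw [e]
  rw [lintegral_finsetSum _ fun j _ => (hmj j).const_mul _,
    ENNReal.ofReal_sum_of_nonneg fun i _ => mul_nonneg (htau i) (hm0 i)]
  refine Finset.sum_le_sum fun i _ => ?_
  rw [lintegral_const_mul _ (hmj i), ENNReal.ofReal_mul (htau i)]
  gcongr
  exact lintegral_sgdIterate_le h hlam hψ hγ le_rfl i

end

section

/-! ### Analysis of the error recursion -/

variable {d n : ℕ}

/-- The effective noise level in the error recursion. -/
def noiseLevel (σ ψ : ℝ) : ℝ := ψ * (2 + σ ^ 2) + σ ^ 2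

lemma noiseLevel_nonneg {σ ψ : ℝ} (hψ : 1 ≤ ψ) : 0 ≤ noiseLevel σ ψ := by
  unfold noiseLevel
  positivity

/-! ### Decoupling and unrolling the recursion -/

section recursion

variable {lam : Fin d → ℝ} {σ ψ η : ℝ} {γ : ℕ → ℝ} {m₀ : Fin d → ℝ}

/-- The two bounds feed each other. If Σ λ_j m_j ≤ 2 + σ², the effective noise is at most
`noiseLevel σ ψ`, and contraction keeps every m_i below m₀_i + η · `noiseLevel σ ψ` because γ ≤ η.
Summing this with the trace condition returns 1 + (2 + σ²)/2 + σ²/2 = 2 + σ², the fixed point of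
that bound. -/
lemma errorBound_le_add (hlam : ∀ i, 0 ≤ lam i) (hψ : 1 ≤ ψ) (hγ0 : ∀ t, 0 ≤ γ t)
    (hγη : ∀ t, γ t ≤ η) (hηlam : ∀ i, 2 * η * lam i ≤ 1) (hm0 : ∀ i, 0 ≤ m₀ i)
    (hm1 : ∑ j, lam j * m₀ j ≤ 1) (htr : η * ψ * ∑ j, lam j ≤ 1 / 2) (t : ℕ) :
    (∀ i, errorBound lam σ ψ γ m₀ t i ≤ m₀ i + η * noiseLevel σ ψ) ∧
      ∑ j, lam j * errorBound lam σ ψ γ m₀ t j ≤ 2 + σ ^ 2 := by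
  have hη : 0 ≤ η := (hγ0 0).trans (hγη 0)
  have hX := noiseLevel_nonneg (σ := σ) hψ
  have hsum : ∀ t, (∀ i, errorBound lam σ ψ γ m₀ t i ≤ m₀ i + η * noiseLevel σ ψ) →
      ∑ j, lam j * errorBound lam σ ψ γ m₀ t j ≤ 2 + σ ^ 2 := by
    intro t h
    have hL : 0 ≤ ∑ j, lam j := Finset.sum_nonneg fun j _ => hlam j
    calc ∑ j, lam j * errorBound lam σ ψ γ m₀ t j
        ≤ ∑ j, (lam j * m₀ j + η * noiseLevel σ ψ * lam j) :=
          Finset.sum_le_sum fun j _ => by nlinarith [mul_le_mul_of_nonneg_left (h j) (hlam j)]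
      _ = ∑ j, lam j * m₀ j + (η * ψ * ∑ j, lam j) * (2 + σ ^ 2) +
            (η * ∑ j, lam j) * σ ^ 2 := by
          rw [Finset.sum_add_distrib, ← Finset.mul_sum]
          unfold noiseLevel
          ring
      _ ≤ 2 + σ ^ 2 := by
          have h1 : η * ∑ j, lam j ≤ η * ψ * ∑ j, lam j := by
            nlinarith [mul_nonneg (mul_nonneg hη hL) (by linarith : 0 ≤ ψ - 1)]
          nlinarith [mul_le_mul_of_nonneg_right htr (by positivity : 0 ≤ 2 + σ ^ 2),
            mul_le_mul_of_nonneg_right (h1.trans htr) (sq_nonneg σ)]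
  refine (fun h => ⟨h, hsum t h⟩) ?_
  induction t with
  | zero => exact fun i => by simpa [errorBound] using mul_nonneg hη hX
  | succ t ih =>
    intro i
    have hX' : ψ * ∑ j, lam j * errorBound lam σ ψ γ m₀ t j + σ ^ 2 ≤ noiseLevel σ ψ := by
      have := mul_le_mul_of_nonneg_left (hsum t ih) (by linarith : 0 ≤ ψ)
      unfold noiseLevel
      linarith
    have hm0i : 0 ≤ m₀ i := hm0 i
    have h1 : 0 ≤ 1 - 2 * γ t * lam i := by
      nlinarith [hηlam i, mul_le_mul_of_nonneg_right (hγη t) (hlam i)]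
    have h2 : 0 ≤ 2 * γ t ^ 2 * lam i := by have := hlam i; positivity
    have h3 : 0 ≤ 2 * γ t * lam i := by have := hlam i; have := hγ0 t; positivity
    calc errorBound lam σ ψ γ m₀ (t + 1) i
        ≤ (1 - 2 * γ t * lam i) * (m₀ i + η * noiseLevel σ ψ) +
            2 * γ t ^ 2 * lam i * noiseLevel σ ψ :=
          add_le_add (mul_le_mul_of_nonneg_left (ih i) h1) (mul_le_mul_of_nonneg_left hX' h2)
      _ ≤ m₀ i + η * noiseLevel σ ψ := by
          nlinarith [mul_nonneg h3 hm0i, mul_nonneg (mul_nonneg h3 hX) (sub_nonneg.2 (hγη t))]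

/-- With the noise level now constant, the coordinates evolve separately, and 1 - x ≤ exp(-x) turns
products of contraction factors into exponentials of sums of step sizes. -/
lemma errorBound_le_unrolled (hlam : ∀ i, 0 ≤ lam i) (hψ : 1 ≤ ψ) (hγ0 : ∀ t, 0 ≤ γ t)
    (hγη : ∀ t, γ t ≤ η) (hηlam : ∀ i, 2 * η * lam i ≤ 1) (hm0 : ∀ i, 0 ≤ m₀ i)
    (hm1 : ∑ j, lam j * m₀ j ≤ 1) (htr : η * ψ * ∑ j, lam j ≤ 1 / 2) (t : ℕ) (i : Fin d) :
    errorBound lam σ ψ γ m₀ t i ≤ Real.exp (-(2 * lam i * ∑ s ∈ Finset.range t, γ s)) * m₀ i +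
      2 * noiseLevel σ ψ * ∑ s ∈ Finset.range t,
        γ s ^ 2 * lam i * Real.exp (-(2 * lam i * ∑ u ∈ Finset.Ico (s + 1) t, γ u)) := by
  have hX := noiseLevel_nonneg (σ := σ) hψ
  induction t with
  | zero => simp [errorBound]
  | succ t ih =>
    have hX' : ψ * ∑ j, lam j * errorBound lam σ ψ γ m₀ t j + σ ^ 2 ≤ noiseLevel σ ψ := by
      have := mul_le_mul_of_nonneg_left
        (errorBound_le_add (σ := σ) hlam hψ hγ0 hγη hηlam hm0 hm1 htr t).2 (by linarith : 0 ≤ ψ)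
      unfold noiseLevel
      linarith
    have h1 : 0 ≤ 1 - 2 * γ t * lam i := by
      nlinarith [hηlam i, mul_le_mul_of_nonneg_right (hγη t) (hlam i)]
    have h2 : 0 ≤ 2 * γ t ^ 2 * lam i := by have := hlam i; positivity
    have hexp : 1 - 2 * γ t * lam i ≤ Real.exp (-(2 * lam i * γ t)) := by
      have := Real.add_one_le_exp (-(2 * lam i * γ t))
      linarith
    set R := Real.exp (-(2 * lam i * ∑ s ∈ Finset.range t, γ s)) * m₀ i +
      2 * noiseLevel σ ψ * ∑ s ∈ Finset.range t,
        γ s ^ 2 * lam i * Real.exp (-(2 * lam i * ∑ u ∈ Finset.Ico (s + 1) t, γ u)) with hR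
    have hR0 : 0 ≤ R := by
      refine add_nonneg (mul_nonneg (Real.exp_pos _).le (hm0 i)) (mul_nonneg (by positivity)
        (Finset.sum_nonneg fun s _ => ?_))
      have := hlam i
      positivity
    calc errorBound lam σ ψ γ m₀ (t + 1) i
        ≤ (1 - 2 * γ t * lam i) * R + 2 * γ t ^ 2 * lam i * noiseLevel σ ψ :=
          add_le_add (mul_le_mul_of_nonneg_left ih h1) (mul_le_mul_of_nonneg_left hX' h2)
      _ ≤ Real.exp (-(2 * lam i * γ t)) * R + 2 * γ t ^ 2 * lam i * noiseLevel σ ψ := by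
          gcongr
      _ = _ := by
          have e : ∀ s ∈ Finset.range t, γ s ^ 2 * lam i *
              Real.exp (-(2 * lam i * ∑ u ∈ Finset.Ico (s + 1) (t + 1), γ u)) =
              Real.exp (-(2 * lam i * γ t)) * (γ s ^ 2 * lam i *
              Real.exp (-(2 * lam i * ∑ u ∈ Finset.Ico (s + 1) t, γ u))) := by
            intro s hs
            rw [Finset.sum_Ico_succ_top (by have := Finset.mem_range.1 hs; omega), mul_add,
              neg_add, Real.exp_add]
            ring
          rw [Finset.sum_range_succ _ t, Finset.sum_range_succ _ t, Finset.sum_congr rfl e,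
            ← Finset.mul_sum, mul_add (2 * lam i), neg_add, Real.exp_add, hR]
          simp only [Finset.Ico_self, Finset.sum_empty, mul_zero, neg_zero, Real.exp_zero]
          ring

end recursion

/-! ### The geometric step-size schedule -/

section schedule

variable {η : ℝ}

lemma stepSize_nonneg (hη : 0 ≤ η) (t : ℕ) : 0 ≤ stepSize η n t := by
  unfold stepSize
  positivity

lemma stepSize_le (hη : 0 ≤ η) (t : ℕ) : stepSize η n t ≤ η :=
  div_le_self hη (one_le_pow₀ (by norm_num))

/-- Only the first phase, at full step size, is counted. -/
lemma sum_range_stepSize_ge (hη : 0 ≤ η) :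
    ((n / Nat.log 2 n : ℕ) : ℝ) * η ≤ ∑ s ∈ Finset.range n, stepSize η n s := by
  set K := n / Nat.log 2 n with hK
  have h : ∑ s ∈ Finset.range K, stepSize η n s = K * η := by
    rw [Finset.sum_congr rfl fun s hs => ?_, Finset.sum_const, Finset.card_range, nsmul_eq_mul]
    rw [stepSize, ← hK, Nat.div_eq_of_lt (Finset.mem_range.1 hs)]
    simp
  rw [← h]
  exact Finset.sum_le_sum_of_subset_of_nonneg
    (Finset.range_subset_range.2 (Nat.div_le_self _ _)) fun s _ _ => stepSize_nonneg hη s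

lemma one_le_log_two (hn : 2 ≤ n) : 1 ≤ Nat.log 2 n :=
  Nat.log_pos (by norm_num) hn

lemma one_le_phase (hn : 2 ≤ n) : 1 ≤ n / Nat.log 2 n :=
  Nat.div_pos (Nat.log_le_self 2 n) (one_le_log_two hn)

lemma sq_mul_exp_neg_half_le {y : ℝ} (hy : 0 ≤ y) : y ^ 2 * Real.exp (-(y / 2)) ≤ 8 := by
  have h := Real.quadratic_le_exp_of_nonneg (x := y / 2) (by linarith)
  rw [Real.exp_neg, ← div_eq_mul_inv, div_le_iff₀ (Real.exp_pos _)]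
  nlinarith

/-- Noise injected at step s is either damped by the next phase or injected with a step size that is
already tiny. The bound does not depend on s or η, which is why one decaying schedule serves all
eigenvalues l. -/
lemma stepSize_sq_mul_exp_le (hn : 2 ≤ n) (hη : 0 ≤ η) {l : ℝ} (hl : 0 < l) (hηl : η * l ≤ 1)
    (s : ℕ) :
    stepSize η n s ^ 2 * l *
        Real.exp (-(2 * l * ∑ u ∈ Finset.Ico (s + 1) n, stepSize η n u)) ≤
      256 / (((n / Nat.log 2 n : ℕ) : ℝ) ^ 2 * l) := by
  have hK1 := one_le_phase hn
  have hL1 := one_le_log_two hn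
  have hKL : n / Nat.log 2 n * Nat.log 2 n ≤ n := Nat.div_mul_le_self _ _
  have hKn : n / Nat.log 2 n ≤ n := Nat.div_le_self _ _
  have hγ0 := stepSize_nonneg (n := n) hη
  have hdef : ∀ t, stepSize η n t = η / 4 ^ (t / (n / Nat.log 2 n)) := fun t => rfl
  set K := n / Nat.log 2 n with hK
  set L := Nat.log 2 n with hL
  have hK0 : (0 : ℝ) < K := by exact_mod_cast hK1
  set γ := stepSize η n s with hγ
  have hsum0 : 0 ≤ ∑ u ∈ Finset.Ico (s + 1) n, stepSize η n u :=
    Finset.sum_nonneg fun u _ => hγ0 u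
  rw [le_div_iff₀ (by positivity)]
  -- If the whole next phase lies before time n, it contributes K γ / 4 to the exponent, and with y
  -- = lKγ the claim is y² exp(-y/2) ≤ 8.
  by_cases hs : (s / K + 2) * K ≤ n
  · have hsub : Finset.Ico ((s / K + 1) * K) ((s / K + 2) * K) ⊆ Finset.Ico (s + 1) n := by
      refine Finset.Ico_subset_Ico ?_ hs
      have := Nat.lt_div_mul_add (a := s) hK1
      nlinarith
    have hval : ∑ u ∈ Finset.Ico ((s / K + 1) * K) ((s / K + 2) * K), stepSize η n u =
        K * (γ / 4) := by
      have e : ∀ u ∈ Finset.Ico ((s / K + 1) * K) ((s / K + 2) * K), stepSize η n u = γ / 4 := by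
        intro u hu
        have hu' := Finset.mem_Ico.1 hu
        have : u / K = s / K + 1 := Nat.div_eq_of_lt_le hu'.1 hu'.2
        rw [hdef, this, pow_succ, ← div_div, ← hdef]
      rw [Finset.sum_congr rfl e, Finset.sum_const, Nat.card_Ico, nsmul_eq_mul, ← Nat.sub_mul]
      simp
    have hge : K * (γ / 4) ≤ ∑ u ∈ Finset.Ico (s + 1) n, stepSize η n u := by
      rw [← hval]
      exact Finset.sum_le_sum_of_subset_of_nonneg hsub fun u _ _ => hγ0 u
    have hy : 0 ≤ l * K * γ := by have := hγ0 s; positivity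
    have h8 := sq_mul_exp_neg_half_le hy
    have hexp : Real.exp (-(2 * l * ∑ u ∈ Finset.Ico (s + 1) n, stepSize η n u)) ≤
        Real.exp (-(l * K * γ / 2)) := by
      refine Real.exp_le_exp.2 (neg_le_neg ?_)
      nlinarith [mul_le_mul_of_nonneg_left hge hl.le]
    calc _ = (l * K * γ) ^ 2 *
          Real.exp (-(2 * l * ∑ u ∈ Finset.Ico (s + 1) n, stepSize η n u)) := by ring
      _ ≤ (l * K * γ) ^ 2 * Real.exp (-(l * K * γ / 2)) := by gcongr
      _ ≤ 256 := by linarith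
  -- Otherwise s is in the last phase or among the leftover steps. Then 4^(s/K) is at least n²/16,
  -- so γ n² ≤ 16 η, and no damping is needed.
  · have hsL : L ≤ s / K + 1 := by
      by_contra hlt
      refine hs (le_trans (Nat.mul_le_mul_right K (?_ : s / K + 2 ≤ L)) ?_)
      · omega
      · rw [mul_comm]; exact hKL
    have hn4 : (n : ℝ) ^ 2 ≤ 16 * 4 ^ (s / K) := by
      have h1 : n < 2 ^ (L + 1) := Nat.lt_pow_succ_log_self (by norm_num) n
      have h2 : 2 ^ (L + 1) ≤ 2 ^ (s / K + 2) := Nat.pow_le_pow_right (by norm_num) (by omega)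
      have h3 : (n : ℝ) ≤ 2 ^ (s / K + 2) := by exact_mod_cast h1.le.trans h2
      calc (n : ℝ) ^ 2 ≤ (2 ^ (s / K + 2)) ^ 2 := by gcongr
        _ = 16 * 4 ^ (s / K) := by
          rw [show (4 : ℝ) = 2 ^ 2 by norm_num, ← pow_mul, ← pow_mul]
          ring
    have hn0 : (1 : ℝ) ≤ n := by exact_mod_cast (by omega : 1 ≤ n)
    have hγn : γ * (n : ℝ) ^ 2 ≤ 16 * η := by
      rw [hγ, hdef, div_mul_eq_mul_div, div_le_iff₀ (by positivity)]
      nlinarith [mul_le_mul_of_nonneg_left hn4 hη]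
    have hγK : γ * K ≤ 16 * η := by
      refine le_trans (mul_le_mul_of_nonneg_left ?_ (hγ0 s)) hγn
      have : (K : ℝ) ≤ n := by exact_mod_cast hKn
      nlinarith
    have hexp : Real.exp (-(2 * l * ∑ u ∈ Finset.Ico (s + 1) n, stepSize η n u)) ≤ 1 :=
      Real.exp_le_one_iff.2 (neg_nonpos.2 (by positivity))
    have hγ0' : 0 ≤ γ := hγ0 s
    have h16 : γ * K * l ≤ 16 := by nlinarith [mul_le_mul_of_nonneg_right hγK hl.le]
    calc _ = (γ * K * l) ^ 2 *
          Real.exp (-(2 * l * ∑ u ∈ Finset.Ico (s + 1) n, stepSize η n u)) := by ring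
      _ ≤ 16 ^ 2 * 1 := by gcongr
      _ = 256 := by norm_num

/-- Each of the n noise contributions obeys both bounds in the minimum: the damped one, useful for
large eigenvalues, and the trivial one η²λ_i, useful for small ones. -/
lemma errorBound_stepSize_le {lam m₀ : Fin d → ℝ} {σ ψ : ℝ} (hn : 2 ≤ n) (hη : 0 ≤ η)
    (hlam : ∀ i, 0 < lam i) (hψ : 1 ≤ ψ) (hηlam : ∀ i, 2 * η * lam i ≤ 1) (hm0 : ∀ i, 0 ≤ m₀ i)
    (hm1 : ∑ j, lam j * m₀ j ≤ 1) (htr : η * ψ * ∑ j, lam j ≤ 1 / 2) (i : Fin d) :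
    errorBound lam σ ψ (stepSize η n) m₀ n i ≤
      Real.exp (-(lam i * (((n / Nat.log 2 n : ℕ) : ℝ) * η))) * m₀ i +
      2 * noiseLevel σ ψ *
        (n * min (256 / (((n / Nat.log 2 n : ℕ) : ℝ) ^ 2 * lam i)) (η ^ 2 * lam i)) := by
  refine (errorBound_le_unrolled (fun i => (hlam i).le) hψ (stepSize_nonneg hη) (stepSize_le hη)
    hηlam hm0 hm1 htr n i).trans (add_le_add ?_ ?_)
  · refine mul_le_mul_of_nonneg_right (Real.exp_le_exp.2 (neg_le_neg ?_)) (hm0 i)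
    have := mul_le_mul_of_nonneg_left (sum_range_stepSize_ge (n := n) hη) (hlam i).le
    have h2 : 0 ≤ lam i * (((n / Nat.log 2 n : ℕ) : ℝ) * η) := by
      have := hlam i; positivity
    linarith
  · refine mul_le_mul_of_nonneg_left ?_ (by have := noiseLevel_nonneg (σ := σ) hψ; positivity)
    refine (Finset.sum_le_card_nsmul _ _ _ fun s _ => le_min (stepSize_sq_mul_exp_le hn hη
      (hlam i) (by nlinarith [hηlam i, mul_nonneg hη (hlam i).le]) s) ?_).trans
      (by rw [Finset.card_range, nsmul_eq_mul])
    have h0 := stepSize_nonneg (n := n) hη s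
    have hl := hlam i
    calc _ ≤ η ^ 2 * lam i * 1 := by
          gcongr
          · exact stepSize_le hη s
          · exact Real.exp_le_one_iff.2 (neg_nonpos.2 (mul_nonneg (by positivity)
              (Finset.sum_nonneg fun u _ => stepSize_nonneg hη u)))
      _ = _ := mul_one _

end schedule

end

section

/-! ### Power-law spectra -/

/-! ### Elementary estimates for power sums -/

section powerSums

/-- A discrete form of the integral comparison, obtained from log x ≤ x - 1 and 1 + y ≤ exp y. With
b = a - 1 it telescopes to the tail bound for Σ i^(-a). -/
lemma mul_rpow_le_sub_rpow {b : ℝ} (hb : 0 < b) {k : ℝ} (hk : 0 < k) :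
    b * (k + 1) ^ (-(b + 1)) ≤ k ^ (-b) - (k + 1) ^ (-b) := by
  have hk1 : 0 < k + 1 := by linarith
  have h1 : 1 + b / (k + 1) ≤ (k / (k + 1)) ^ (-b) := by
    have hlog : Real.log (k / (k + 1)) ≤ -(1 / (k + 1)) := by
      have := Real.log_le_sub_one_of_pos (div_pos hk hk1)
      have e : k / (k + 1) - 1 = -(1 / (k + 1)) := by field_simp; ring
      linarith
    rw [Real.rpow_def_of_pos (div_pos hk hk1)]
    refine le_trans ?_ (Real.add_one_le_exp _)
    have := mul_le_mul_of_nonneg_left hlog hb.le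
    have e : b / (k + 1) = b * (1 / (k + 1)) := by ring
    linarith
  have h2 : (k / (k + 1)) ^ (-b) * (k + 1) ^ (-b) = k ^ (-b) := by
    rw [← Real.mul_rpow (by positivity) hk1.le, div_mul_cancel₀ _ hk1.ne']
  have h3 : (k + 1) ^ (-(b + 1)) = (k + 1) ^ (-b) / (k + 1) := by
    rw [neg_add, ← sub_eq_add_neg, Real.rpow_sub_one hk1.ne']
  have h4 := mul_le_mul_of_nonneg_right h1 (Real.rpow_pos_of_pos hk1 (-b)).le
  rw [h2] at h4
  rw [h3]
  have e : b * ((k + 1) ^ (-b) / (k + 1)) = b / (k + 1) * (k + 1) ^ (-b) := by ring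
  linarith

lemma sum_Ico_rpow_neg_le {a : ℝ} (ha : 1 < a) {M : ℕ} (hM : 1 ≤ M) (d : ℕ) :
    ∑ i ∈ Finset.Ico M d, ((i : ℝ) + 1) ^ (-a) ≤ (M : ℝ) ^ (1 - a) / (a - 1) := by
  have hb : 0 < a - 1 := by linarith
  rcases le_or_gt M d with hMd | hMd
  · have key : (a - 1) * ∑ i ∈ Finset.Ico M d, ((i : ℝ) + 1) ^ (-a) ≤
        (M : ℝ) ^ (1 - a) - (d : ℝ) ^ (1 - a) := by
      induction d, hMd using Nat.le_induction with
      | base => simp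
      | succ k hk ih =>
        have hk0 : (0 : ℝ) < k := by exact_mod_cast (by omega : 0 < k)
        have := mul_rpow_le_sub_rpow hb hk0
        rw [sub_add_cancel, neg_sub] at this
        rw [Finset.sum_Ico_succ_top hk, mul_add]
        push_cast
        linarith
    rw [le_div_iff₀ hb]
    have : (0 : ℝ) ≤ (d : ℝ) ^ (1 - a) := by positivity
    linarith
  · rw [Finset.Ico_eq_empty (by omega)]
    simp only [Finset.sum_empty]
    positivity

lemma sum_range_rpow_neg_le {a : ℝ} (ha : 1 < a) (d : ℕ) :
    ∑ i ∈ Finset.range d, ((i : ℝ) + 1) ^ (-a) ≤ 1 + 1 / (a - 1) := by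
  have hb : 0 < a - 1 := by linarith
  rcases Nat.eq_zero_or_pos d with rfl | hd
  · simp only [Finset.range_zero, Finset.sum_empty]
    positivity
  · rw [Finset.range_eq_Ico, Finset.sum_eq_sum_Ico_succ_bot hd]
    have := sum_Ico_rpow_neg_le ha le_rfl d
    simp only [Nat.cast_one, Real.one_rpow] at this
    simpa using this

/-- Bernoulli's inequality gives (k+1)^(a+1) - k^(a+1) ≤ (a+1)(k+1)^a, which telescopes. -/
lemma rpow_le_sum_range {a : ℝ} (ha : 0 ≤ a) (k : ℕ) :
    (k : ℝ) ^ (a + 1) ≤ (a + 1) * ∑ j ∈ Finset.range k, ((j : ℝ) + 1) ^ a := by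
  induction k with
  | zero => simp [Real.zero_rpow (by linarith : a + 1 ≠ 0)]
  | succ k ih =>
    rw [Finset.sum_range_succ, mul_add]
    have hk1 : (0 : ℝ) < k + 1 := by positivity
    have h := one_add_mul_self_le_rpow_one_add (s := -(1 / ((k : ℝ) + 1)))
      (by rw [neg_le_neg_iff, div_le_one hk1]; simp) (p := a + 1) (by linarith)
    have e : 1 + -(1 / ((k : ℝ) + 1)) = k / (k + 1) := by field_simp; ring
    rw [e, Real.div_rpow (by positivity) hk1.le, le_div_iff₀ (by positivity)] at h
    have e2 : ((k : ℝ) + 1) ^ (a + 1) = (k + 1) ^ a * (k + 1) := Real.rpow_add_one hk1.ne' a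
    have e3 : (1 + (a + 1) * -(1 / ((k : ℝ) + 1))) * (k + 1) ^ (a + 1) =
        (k + 1) ^ (a + 1) - (a + 1) * (k + 1) ^ a := by
      rw [e2]
      field_simp
      ring
    push_cast
    linarith

/-- For y > 0, y^p ≤ 1 + y^⌈p⌉ ≤ (1 + ⌈p⌉!) exp y. -/
lemma exists_exp_neg_le_rpow (p : ℝ) (hp : 0 ≤ p) :
    ∃ C : ℝ, 0 < C ∧ ∀ y : ℝ, 0 < y → Real.exp (-y) ≤ C * y ^ (-p) := by
  refine ⟨1 + (⌈p⌉₊.factorial : ℝ), by positivity, fun y hy => ?_⟩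
  rw [Real.rpow_neg hy.le, ← div_eq_mul_inv, le_div_iff₀ (by positivity), Real.exp_neg,
    inv_mul_le_iff₀ (Real.exp_pos _)]
  have h1 : y ^ p ≤ 1 + y ^ ⌈p⌉₊ := by
    rcases le_or_gt y 1 with h | h
    · exact (Real.rpow_le_one hy.le h hp).trans (by simp; positivity)
    · have : y ^ p ≤ y ^ (⌈p⌉₊ : ℝ) := Real.rpow_le_rpow_of_exponent_le h.le (Nat.le_ceil p)
      rw [Real.rpow_natCast] at this
      linarith
  have h2 := Real.pow_div_factorial_le_exp y hy.le ⌈p⌉₊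
  rw [div_le_iff₀ (by positivity)] at h2
  have h3 := Real.one_le_exp hy.le
  linarith

end powerSums

/-- The initial step size of order `n ^ (-1 / (1 + a))`. -/
def initialStep (a ψ : ℝ) (n : ℕ) : ℝ :=
  1 / (2 * ψ * (1 + 1 / (a - 1))) * ((n : ℝ) ^ (1 / (1 + a)))⁻¹

/-! ### The error recursion for the spectrum i^(-a) -/

section powerLaw

variable {a σ ψ : ℝ} {d n : ℕ}

/-- The spectrum `i ^ (-a)` of the source covariance. -/
def powerSpectrum (a : ℝ) (d : ℕ) : Fin d → ℝ := fun i => ((i : ℝ) + 1) ^ (-a)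

lemma powerSpectrum_pos (i : Fin d) : 0 < powerSpectrum a d i :=
  Real.rpow_pos_of_pos (by positivity) _

lemma powerSpectrum_le_one (ha : 0 ≤ a) (i : Fin d) : powerSpectrum a d i ≤ 1 :=
  Real.rpow_le_one_of_one_le_of_nonpos (by simp) (by linarith)

lemma sum_powerSpectrum_le (ha : 1 < a) : ∑ i, powerSpectrum a d i ≤ 1 + 1 / (a - 1) := by
  unfold powerSpectrum
  rw [← Finset.sum_range fun i => ((i : ℝ) + 1) ^ (-a)]
  exact sum_range_rpow_neg_le ha d

lemma initialStep_pos (ha : 1 < a) (hψ : 1 ≤ ψ) (hn : 0 < n) : 0 < initialStep a ψ n := by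
  have : 0 < a - 1 := by linarith
  unfold initialStep
  positivity

lemma one_le_rpow_inv (ha : 0 < a) (hn : 1 ≤ n) : 1 ≤ (n : ℝ) ^ (1 / (1 + a)) :=
  Real.one_le_rpow (by exact_mod_cast hn) (by positivity)

/-- Since 1 + 1/(a-1) bounds the trace of S in every dimension, this is the trace condition of
`errorBound_le_add`, uniformly in d. -/
lemma initialStep_mul_le (ha : 1 < a) (hψ : 1 ≤ ψ) (hn : 1 ≤ n) :
    initialStep a ψ n * ψ * (1 + 1 / (a - 1)) ≤ 1 / 2 := by
  have h0 : 0 < a - 1 := by linarith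
  have hZ : 0 < 1 + 1 / (a - 1) := by positivity
  have hN := inv_le_one_of_one_le₀ (one_le_rpow_inv (a := a) (by linarith) hn)
  have e : initialStep a ψ n * ψ * (1 + 1 / (a - 1)) = 1 / 2 * ((n : ℝ) ^ (1 / (1 + a)))⁻¹ := by
    unfold initialStep
    field_simp
  rw [e]
  linarith

lemma two_mul_initialStep_le (ha : 1 < a) (hψ : 1 ≤ ψ) (hn : 1 ≤ n) :
    2 * initialStep a ψ n ≤ 1 := by
  have h0 : 0 < a - 1 := by linarith
  have h1 : 1 ≤ ψ * (1 + 1 / (a - 1)) := by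
    have : 0 ≤ 1 / (a - 1) := by positivity
    nlinarith
  have h2 := initialStep_mul_le ha hψ hn
  have h3 := initialStep_pos ha hψ hn
  nlinarith

lemma phase_lower_bound (hn : 2 ≤ n) :
    (n : ℝ) / (2 * Nat.log 2 n) ≤ ((n / Nat.log 2 n : ℕ) : ℝ) := by
  have hL := one_le_log_two hn
  have hK := one_le_phase hn
  have hL0 : (0 : ℝ) < Nat.log 2 n := by exact_mod_cast hL
  rw [div_le_iff₀ (by positivity)]
  have h : n < n / Nat.log 2 n * Nat.log 2 n + Nat.log 2 n := Nat.lt_div_mul_add hL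
  have h2 : n ≤ n / Nat.log 2 n * (2 * Nat.log 2 n) := by nlinarith
  exact_mod_cast h2

/-- The exponential bias is weakened to a power of i/N whose exponent p is left free, to be matched
later with the weights of the target norm. The logarithms come from the phase length K ≥ n/(2 log₂
n): the bias costs L^p and the variance L², hence the two conditions on q. -/
lemma exists_errorBound_powerSpectrum_le (ha : 1 < a) (hψ : 1 ≤ ψ) (σ : ℝ) {p : ℝ} (hp : 0 ≤ p)
    {q : ℕ} (hpq : p ≤ q) (hq : 2 ≤ q) :
    ∃ C : ℝ, 0 < C ∧ ∀ (d n : ℕ) (m₀ : Fin d → ℝ), 2 ≤ n → (∀ i, 0 ≤ m₀ i) → ∑ i, m₀ i ≤ 1 →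
      ∀ i, errorBound (powerSpectrum a d) σ ψ (stepSize (initialStep a ψ n) n) m₀ n i ≤
        C * (Nat.log 2 n : ℝ) ^ q * ((((i : ℝ) + 1) / (n : ℝ) ^ (1 / (1 + a))) ^ (a * p) * m₀ i +
          min (((i : ℝ) + 1) ^ a / n)
            (n / ((n : ℝ) ^ (1 / (1 + a))) ^ 2 * ((i : ℝ) + 1) ^ (-a))) := by
  obtain ⟨C₀, hC₀, hexp⟩ := exists_exp_neg_le_rpow p hp
  have ha1 : 0 < a - 1 := by linarith
  set c := 1 / (2 * ψ * (1 + 1 / (a - 1))) with hc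
  have hc0 : 0 < c := by positivity
  have hX := noiseLevel_nonneg (σ := σ) hψ
  refine ⟨C₀ * (2 / c) ^ p + 2 * noiseLevel σ ψ * 1024, by positivity,
    fun d n m₀ hn hm0 hm1 i => ?_⟩
  have hn1 : 1 ≤ n := by omega
  have hn0 : (0 : ℝ) < n := by exact_mod_cast hn1
  have hη := initialStep_pos ha hψ hn1
  have h2η := two_mul_initialStep_le ha hψ hn1
  have hηlam : ∀ i, 2 * initialStep a ψ n * powerSpectrum a d i ≤ 1 := fun i => by
    nlinarith [powerSpectrum_le_one (a := a) (by linarith) i, powerSpectrum_pos (a := a) i]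
  have hmain := errorBound_stepSize_le (σ := σ) (m₀ := m₀) hn hη.le powerSpectrum_pos hψ hηlam hm0
    ((Finset.sum_le_sum fun j _ => mul_le_of_le_one_left (hm0 j)
      (powerSpectrum_le_one (a := a) (by linarith) j)).trans hm1)
    ((mul_le_mul_of_nonneg_left (sum_powerSpectrum_le ha) (by positivity)).trans
      (initialStep_mul_le ha hψ hn1)) i
  refine hmain.trans ?_
  have hη' : initialStep a ψ n = c * ((n : ℝ) ^ (1 / (1 + a)))⁻¹ := rfl
  have hN1 := one_le_rpow_inv (a := a) (n := n) (by linarith) hn1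
  have hNa : ((n : ℝ) ^ (1 / (1 + a))) ^ (a + 1) = n := by
    rw [← Real.rpow_mul hn0.le, add_comm a 1, one_div_mul_cancel (by linarith), Real.rpow_one]
  have hKn := phase_lower_bound hn
  have hL1 : (1 : ℝ) ≤ Nat.log 2 n := by exact_mod_cast one_le_log_two hn
  set L : ℝ := (Nat.log 2 n : ℝ) with hL
  set K : ℝ := ((n / Nat.log 2 n : ℕ) : ℝ) with hK
  set N : ℝ := (n : ℝ) ^ (1 / (1 + a)) with hN
  set x : ℝ := (i : ℝ) + 1 with hx
  have hx0 : 0 < x := by positivity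
  have hN0 : 0 < N := by linarith
  have hlam : powerSpectrum a d i = x ^ (-a) := rfl
  have hK0 : 0 < K := lt_of_lt_of_le (by positivity) hKn
  have hLq : L ^ p ≤ L ^ q := by
    rw [← Real.rpow_natCast]
    exact Real.rpow_le_rpow_of_exponent_le hL1 hpq
  have hL2 : L ^ 2 ≤ L ^ q := pow_le_pow_right₀ hL1 hq
  -- The exponent is at least (c / 2L)(N / x)^a because n / N = N^a.
  have hbias : Real.exp (-(powerSpectrum a d i * (K * initialStep a ψ n))) ≤
      C₀ * (2 / c) ^ p * L ^ q * (x / N) ^ (a * p) := by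
    have hNa' : (n : ℝ) = N ^ a * N := by rw [← hNa, Real.rpow_add_one hN0.ne']
    have hy : c / (2 * L) * (N / x) ^ a ≤ powerSpectrum a d i * (K * initialStep a ψ n) := by
      calc c / (2 * L) * (N / x) ^ a = x ^ (-a) * ((n / (2 * L)) * (c * N⁻¹)) := by
            rw [Real.div_rpow hN0.le hx0.le, Real.rpow_neg hx0.le, hNa']
            field_simp
        _ ≤ _ := by
            rw [hlam, hη']
            gcongr
    have hypos : 0 < c / (2 * L) * (N / x) ^ a := by positivity
    calc _ ≤ Real.exp (-(c / (2 * L) * (N / x) ^ a)) := Real.exp_le_exp.2 (neg_le_neg hy)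
      _ ≤ C₀ * (c / (2 * L) * (N / x) ^ a) ^ (-p) := hexp _ hypos
      _ = C₀ * ((2 / c) ^ p * L ^ p * (x / N) ^ (a * p)) := by
          rw [← Real.mul_rpow (by positivity) (by positivity), Real.rpow_mul (by positivity),
            ← Real.mul_rpow (by positivity) (by positivity), Real.rpow_neg hypos.le,
            ← Real.inv_rpow hypos.le]
          congr 2
          rw [mul_inv, ← Real.inv_rpow (by positivity), inv_div, inv_div]
          ring
      _ ≤ C₀ * ((2 / c) ^ p * L ^ q * (x / N) ^ (a * p)) := by gcongr
      _ = _ := by ring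
  have hc1 : c ≤ 1 := by
    have h1 : 0 ≤ 1 / (a - 1) := by positivity
    rw [hc, div_le_one (by positivity)]
    nlinarith
  have hvar : n * min (256 / (K ^ 2 * powerSpectrum a d i))
      (initialStep a ψ n ^ 2 * powerSpectrum a d i) ≤
      1024 * L ^ q * min (x ^ a / n) (n / N ^ 2 * x ^ (-a)) := by
    rw [mul_min_of_nonneg _ _ hn0.le, mul_min_of_nonneg _ _ (by positivity)]
    refine min_le_min ?_ ?_
    · have hxa : x ^ (-a) = (x ^ a)⁻¹ := Real.rpow_neg hx0.le a
      have hxa0 : 0 < x ^ a := by positivity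
      calc n * (256 / (K ^ 2 * powerSpectrum a d i))
          ≤ n * (256 / ((n / (2 * L)) ^ 2 * powerSpectrum a d i)) := by
            have := powerSpectrum_pos (a := a) i
            gcongr
        _ = 1024 * L ^ 2 * (x ^ a / n) := by
            rw [hlam, hxa]
            field_simp
            norm_num
        _ ≤ _ := by gcongr
    · rw [hlam, hη']
      have h1 : 1 ≤ 1024 * L ^ q := by
        have := one_le_pow₀ (n := q) hL1
        linarith
      calc n * ((c * N⁻¹) ^ 2 * x ^ (-a)) = c ^ 2 * (n / N ^ 2 * x ^ (-a)) := by
            rw [mul_pow, inv_pow]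
            ring
        _ ≤ 1 ^ 2 * (n / N ^ 2 * x ^ (-a)) := by gcongr
        _ ≤ 1024 * L ^ q * (n / N ^ 2 * x ^ (-a)) := by
            rw [one_pow]
            gcongr
  have hm0i := hm0 i
  set V := min (x ^ a / n) (n / N ^ 2 * x ^ (-a)) with hV
  have hV0 : 0 ≤ V := by positivity
  calc _ ≤ C₀ * (2 / c) ^ p * L ^ q * (x / N) ^ (a * p) * m₀ i +
        2 * noiseLevel σ ψ * (1024 * L ^ q * V) := by gcongr
    -- Adding the two missing cross products lets the sum of both constants factor out.
    _ ≤ C₀ * (2 / c) ^ p * L ^ q * (x / N) ^ (a * p) * m₀ i +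
        2 * noiseLevel σ ψ * (1024 * L ^ q * V) +
        (2 * noiseLevel σ ψ * 1024 * L ^ q * ((x / N) ^ (a * p) * m₀ i) +
          C₀ * (2 / c) ^ p * L ^ q * V) := le_add_of_nonneg_right (by positivity)
    _ = _ := by ring

/-- The sum is split at M = ⌊N⌋, where the minimum changes branch. Below, θ ≤ a + 1 reduces the
terms to N^(-θ)/i, so a harmonic sum and hence one logarithm appear. Above, the tail of Σ i^(-a) is
of order N^(1-a) and cancels n/N² = N^(a-1). -/
lemma sum_min_powerLaw_le {θ : ℝ} (ha : 1 < a) (hθ0 : 0 ≤ θ) (hθ : θ ≤ a + 1) (hn : 2 ≤ n) :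
    ∑ i : Fin d, ((i : ℝ) + 1) ^ (-θ) * min (((i : ℝ) + 1) ^ a / n)
        (n / ((n : ℝ) ^ (1 / (1 + a))) ^ 2 * ((i : ℝ) + 1) ^ (-a)) ≤
      (3 + 2 ^ (a - 1) / (a - 1)) * Nat.log 2 n * ((n : ℝ) ^ (1 / (1 + a))) ^ (-θ) := by
  have hn1 : 1 ≤ n := by omega
  have hn0 : (0 : ℝ) < n := by exact_mod_cast hn1
  have hN1 := one_le_rpow_inv (a := a) (n := n) (by linarith) hn1
  have hNn : (n : ℝ) ^ (1 / (1 + a)) ≤ n := by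
    conv_rhs => rw [← Real.rpow_one (n : ℝ)]
    exact Real.rpow_le_rpow_of_exponent_le (by exact_mod_cast hn1)
      ((div_le_one (by linarith)).2 (by linarith))
  have hNa : ((n : ℝ) ^ (1 / (1 + a))) ^ (a + 1) = n := by
    rw [← Real.rpow_mul hn0.le, add_comm a 1, one_div_mul_cancel (by linarith), Real.rpow_one]
  have hL1 : (1 : ℝ) ≤ Nat.log 2 n := by exact_mod_cast one_le_log_two hn
  have hlogn : Real.log n ≤ 2 * Nat.log 2 n := by
    have h1 : (n : ℝ) ≤ 2 ^ (Nat.log 2 n + 1) := by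
      exact_mod_cast (Nat.lt_pow_succ_log_self (by norm_num) n).le
    have h2 := Real.log_le_log hn0 h1
    rw [Real.log_pow] at h2
    have h3 := Real.log_two_lt_d9
    have h4 := Real.log_pos one_lt_two
    push_cast at h2
    nlinarith
  set N : ℝ := (n : ℝ) ^ (1 / (1 + a)) with hN
  have hN0 : 0 < N := by linarith
  set M := ⌊N⌋₊ with hM
  have hM1 : 1 ≤ M := Nat.one_le_floor_iff N |>.2 hN1
  have hMN : (M : ℝ) ≤ N := Nat.floor_le hN0.le
  have hNM : N / 2 ≤ M := by
    have := Nat.lt_floor_add_one N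
    have : (1 : ℝ) ≤ M := by exact_mod_cast hM1
    linarith
  have hM0 : (0 : ℝ) < M := by exact_mod_cast hM1
  have ha1 : 0 < a - 1 := by linarith
  let f : ℕ → ℝ := fun i => ((i : ℝ) + 1) ^ (-θ) * min (((i : ℝ) + 1) ^ a / n)
        (n / N ^ 2 * ((i : ℝ) + 1) ^ (-a))
  have hf0 : ∀ i, 0 ≤ f i := fun i => by positivity
  have hsmall : ∀ i ∈ Finset.range M, f i ≤ N ^ (-θ) * ((i : ℝ) + 1)⁻¹ := by
    intro i hi
    have hx0 : (0 : ℝ) < (i : ℝ) + 1 := by positivity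
    -- The index i stands for coordinate i + 1, so the range below M is exactly the set of
    -- coordinates at most N.
    have hxN : (i : ℝ) + 1 ≤ N := by
      refine le_trans ?_ hMN
      exact_mod_cast Nat.succ_le_of_lt (Finset.mem_range.1 hi)
    set x : ℝ := (i : ℝ) + 1
    calc f i ≤ x ^ (-θ) * (x ^ a / n) := by
          simp only [f]
          gcongr
          exact min_le_left _ _
      _ = x ^ (a + 1 - θ) * x⁻¹ / N ^ (a + 1) := by
          rw [hNa, ← div_eq_mul_inv, ← Real.rpow_sub_one hx0.ne', mul_div_assoc',
            ← Real.rpow_add hx0]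
          congr 2
          ring
      _ ≤ N ^ (a + 1 - θ) * x⁻¹ / N ^ (a + 1) := by
          gcongr
      _ = N ^ (-θ) * x⁻¹ := by
          rw [Real.rpow_sub hN0, Real.rpow_neg hN0.le]
          field_simp
  have hlarge : ∀ i ∈ Finset.Ico M d, f i ≤ N ^ (-θ) * (N ^ (a - 1) * ((i : ℝ) + 1) ^ (-a)) := by
    intro i hi
    have hx0 : (0 : ℝ) < (i : ℝ) + 1 := by positivity
    have hxN : N ≤ (i : ℝ) + 1 := by
      have h1 := Nat.lt_floor_add_one N
      have h2 : (M : ℝ) ≤ i := by exact_mod_cast (Finset.mem_Ico.1 hi).1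
      linarith
    set x : ℝ := (i : ℝ) + 1
    have e : n / N ^ 2 = N ^ (a - 1) := by
      rw [← hNa, ← Real.rpow_natCast, ← Real.rpow_sub hN0]
      congr 1
      push_cast
      ring
    calc f i ≤ x ^ (-θ) * (N ^ (a - 1) * x ^ (-a)) := by
          simp only [f]
          rw [← e]
          gcongr
          exact min_le_right _ _
      _ ≤ _ := by
          refine mul_le_mul_of_nonneg_right ?_ (by positivity)
          exact Real.rpow_le_rpow_of_nonpos hN0 hxN (by linarith)
  have hharm : ∑ i ∈ Finset.range M, ((i : ℝ) + 1)⁻¹ ≤ 3 * Nat.log 2 n := by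
    have h1 := harmonic_le_one_add_log M
    have h2 : ((harmonic M : ℚ) : ℝ) = ∑ i ∈ Finset.range M, ((i : ℝ) + 1)⁻¹ := by
      simp [harmonic]
    have h3 := Real.log_le_log hM0 (hMN.trans hNn)
    rw [h2] at h1
    linarith
  have htail : N ^ (a - 1) * ∑ i ∈ Finset.Ico M d, ((i : ℝ) + 1) ^ (-a) ≤
      2 ^ (a - 1) / (a - 1) := by
    have h1 : (M : ℝ) ^ (1 - a) ≤ (N / 2) ^ (1 - a) :=
      Real.rpow_le_rpow_of_nonpos (by positivity) hNM (by linarith)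
    calc _ ≤ N ^ (a - 1) * ((N / 2) ^ (1 - a) / (a - 1)) := by
          refine mul_le_mul_of_nonneg_left ((sum_Ico_rpow_neg_le ha hM1 d).trans ?_)
            (by positivity)
          gcongr
      _ = _ := by
          rw [show 1 - a = -(a - 1) by ring, Real.rpow_neg (by positivity),
            Real.div_rpow hN0.le (by norm_num)]
          field_simp
  have hNθ : 0 < N ^ (-θ) := by positivity
  rw [← Finset.sum_range f]
  have hsub : Finset.range d ⊆ Finset.range M ∪ Finset.Ico M d := by
    intro i hi
    simp only [Finset.mem_union, Finset.mem_range, Finset.mem_Ico] at *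
    omega
  have hdisj : Disjoint (Finset.range M) (Finset.Ico M d) := by
    rw [Finset.disjoint_left]
    intro i h1 h2
    simp only [Finset.mem_range, Finset.mem_Ico] at *
    omega
  calc ∑ i ∈ Finset.range d, f i
      ≤ ∑ i ∈ Finset.range M ∪ Finset.Ico M d, f i :=
        Finset.sum_le_sum_of_subset_of_nonneg hsub fun i _ _ => hf0 i
    _ = ∑ i ∈ Finset.range M, f i + ∑ i ∈ Finset.Ico M d, f i := Finset.sum_union hdisj
    _ ≤ N ^ (-θ) * (3 * Nat.log 2 n) + N ^ (-θ) * (2 ^ (a - 1) / (a - 1)) := by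
        refine add_le_add ((Finset.sum_le_sum hsmall).trans ?_)
          ((Finset.sum_le_sum hlarge).trans ?_)
        · rw [← Finset.mul_sum]
          gcongr
        · rw [← Finset.mul_sum, ← Finset.mul_sum]
          gcongr
    _ ≤ _ := by
        have h1 : 0 ≤ N ^ (-θ) * (2 ^ (a - 1) / (a - 1)) := by positivity
        nlinarith [mul_nonneg h1 (sub_nonneg.2 hL1)]

/-- The choice p = θ/a makes the weight i^(-θ) cancel the bias power (i/N)^θ, leaving N^(-θ) Σ m₀_i.
-/
lemma exists_sum_errorBound_le_rpow (ha : 1 < a) (hψ : 1 ≤ ψ) (σ : ℝ) {θ : ℝ} (hθ0 : 0 ≤ θ)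
    (hθ : θ ≤ a + 1) {q : ℕ} (hpq : θ / a ≤ q) (hq : 2 ≤ q) :
    ∃ C : ℝ, 0 < C ∧ ∀ (d n : ℕ) (m₀ : Fin d → ℝ), 2 ≤ n → (∀ i, 0 ≤ m₀ i) → ∑ i, m₀ i ≤ 1 →
      ∑ i : Fin d, ((i : ℝ) + 1) ^ (-θ) *
        errorBound (powerSpectrum a d) σ ψ (stepSize (initialStep a ψ n) n) m₀ n i ≤
        C * (Nat.log 2 n : ℝ) ^ (q + 1) * (n : ℝ) ^ (-(θ / (1 + a))) := by
  obtain ⟨C, hC, h⟩ := exists_errorBound_powerSpectrum_le ha hψ σ (p := θ / a) (by positivity)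
    hpq hq
  have ha1 : 0 < a - 1 := by linarith
  refine ⟨C * (1 + (3 + 2 ^ (a - 1) / (a - 1))), by positivity, fun d n m₀ hn hm0 hm1 => ?_⟩
  have hsum := sum_min_powerLaw_le (d := d) ha hθ0 hθ hn
  have hn0 : (0 : ℝ) < n := by exact_mod_cast (by omega : 0 < n)
  have hL1 : (1 : ℝ) ≤ Nat.log 2 n := by exact_mod_cast one_le_log_two hn
  have e : (n : ℝ) ^ (-(θ / (1 + a))) = ((n : ℝ) ^ (1 / (1 + a))) ^ (-θ) := by
    rw [← Real.rpow_mul hn0.le]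
    congr 1
    ring
  rw [e]
  have hN0 : 0 < (n : ℝ) ^ (1 / (1 + a)) := by positivity
  have hh := h d n m₀ hn hm0 hm1
  set L : ℝ := (Nat.log 2 n : ℝ)
  set N : ℝ := (n : ℝ) ^ (1 / (1 + a))
  have hNθ : 0 < N ^ (-θ) := by positivity
  set B : ℝ := 3 + 2 ^ (a - 1) / (a - 1)
  calc _ ≤ ∑ i : Fin d, (C * L ^ q * N ^ (-θ) * m₀ i + C * L ^ q * (((i : ℝ) + 1) ^ (-θ) *
        min (((i : ℝ) + 1) ^ a / n) (n / N ^ 2 * ((i : ℝ) + 1) ^ (-a)))) := by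
        refine Finset.sum_le_sum fun i _ => ?_
        have hx0 : (0 : ℝ) < (i : ℝ) + 1 := by positivity
        refine (mul_le_mul_of_nonneg_left (hh i) (by positivity)).trans_eq ?_
        have e2 : (((i : ℝ) + 1) / N) ^ (a * (θ / a)) = ((i : ℝ) + 1) ^ θ * N ^ (-θ) := by
          rw [mul_div_cancel₀ _ (by linarith : a ≠ 0), Real.div_rpow hx0.le hN0.le,
            Real.rpow_neg hN0.le, div_eq_mul_inv]
        rw [e2, Real.rpow_neg hx0.le θ]
        have := Real.rpow_pos_of_pos hx0 θ
        field_simp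
    _ = C * L ^ q * N ^ (-θ) * ∑ i, m₀ i + C * L ^ q * ∑ i : Fin d, (((i : ℝ) + 1) ^ (-θ) *
        min (((i : ℝ) + 1) ^ a / n) (n / N ^ 2 * ((i : ℝ) + 1) ^ (-a))) := by
        rw [Finset.sum_add_distrib, ← Finset.mul_sum, ← Finset.mul_sum]
    _ ≤ C * L ^ q * N ^ (-θ) * L + C * L ^ q * (B * L * N ^ (-θ)) := by
        gcongr
        linarith
    _ = _ := by
        rw [pow_succ]
        ring

/-- Used when n ≥ d^(a+1), where every coordinate is learned. The choice p = (a+1)/a makes the bias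
factor i^(a+1)/n, so bias and variance are both compared with Σ τ_i i^a / n. -/
lemma exists_sum_errorBound_le_parametric (ha : 1 < a) (hψ : 1 ≤ ψ) (σ : ℝ) {q : ℕ}
    (hq : 2 ≤ q) :
    ∃ C : ℝ, 0 < C ∧ ∀ (d n : ℕ) (m₀ tau : Fin d → ℝ), 2 ≤ n → (∀ i, 0 ≤ m₀ i) →
      ∑ i, m₀ i ≤ 1 → (∀ i, 0 ≤ tau i) → Antitone tau →
      ∑ i : Fin d, tau i *
        errorBound (powerSpectrum a d) σ ψ (stepSize (initialStep a ψ n) n) m₀ n i ≤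
        C * (Nat.log 2 n : ℝ) ^ q * ((∑ i : Fin d, tau i * ((i : ℝ) + 1) ^ a) / n) := by
  have hp : (a + 1) / a ≤ q := by
    have h2 : (2 : ℝ) ≤ q := by exact_mod_cast hq
    rw [div_le_iff₀ (by linarith)]
    nlinarith
  obtain ⟨C, hC, h⟩ := exists_errorBound_powerSpectrum_le ha hψ σ (p := (a + 1) / a)
    (by positivity) hp hq
  refine ⟨C * (a + 2), by positivity, fun d n m₀ tau hn hm0 hm1 ht0 htau => ?_⟩
  have hn0 : (0 : ℝ) < n := by exact_mod_cast (by omega : 0 < n)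
  have hh := h d n m₀ hn hm0 hm1
  have hNa : ((n : ℝ) ^ (1 / (1 + a))) ^ (a + 1) = n := by
    rw [← Real.rpow_mul hn0.le, add_comm a 1, one_div_mul_cancel (by linarith), Real.rpow_one]
  set L : ℝ := (Nat.log 2 n : ℝ)
  set N : ℝ := (n : ℝ) ^ (1 / (1 + a))
  set R := ∑ i : Fin d, tau i * ((i : ℝ) + 1) ^ a with hR
  have hN0 : 0 < N := by positivity
  have hR0 : 0 ≤ R := Finset.sum_nonneg fun i _ => mul_nonneg (ht0 i) (by positivity)
  -- Since tau is antitone, tau i can be replaced by tau j under the sum of j^a over j ≤ i.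
  have hbig : ∀ i : Fin d, tau i * ((i : ℝ) + 1) ^ (a + 1) ≤ (a + 1) * R := by
    intro i
    have h1 := rpow_le_sum_range (a := a) (by linarith) ((i : ℕ) + 1)
    push_cast at h1
    have h2 : tau i * ∑ j ∈ Finset.range ((i : ℕ) + 1), ((j : ℝ) + 1) ^ a ≤ R := by
      let g : ℕ → ℝ := fun j => if hj : j < d then tau ⟨j, hj⟩ * ((j : ℝ) + 1) ^ a else 0
      have hg : R = ∑ j ∈ Finset.range d, g j := by
        rw [Finset.sum_range]
        simp [g, hR]
      have hg0 : ∀ j, 0 ≤ g j := fun j => by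
        simp only [g]
        split
        · exact mul_nonneg (ht0 _) (by positivity)
        · exact le_rfl
      rw [hg, Finset.mul_sum]
      refine le_trans (Finset.sum_le_sum fun j hj => ?_) (Finset.sum_le_sum_of_subset_of_nonneg
        (Finset.range_subset_range.2 i.2) fun j _ _ => hg0 j)
      have hji := Finset.mem_range.1 hj
      have hjd : j < d := by omega
      simp only [g, hjd, dif_pos]
      refine mul_le_mul_of_nonneg_right (htau ?_) (by positivity)
      exact Fin.mk_le_of_le_val (by omega)
    nlinarith [mul_le_mul_of_nonneg_left h1 (ht0 i),
      mul_le_mul_of_nonneg_left h2 (by linarith : 0 ≤ a + 1)]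
  calc _ ≤ ∑ i : Fin d, (C * L ^ q * ((a + 1) * R / n) * m₀ i +
        C * L ^ q / n * (tau i * ((i : ℝ) + 1) ^ a)) := by
        refine Finset.sum_le_sum fun i _ => ?_
        have hx0 : (0 : ℝ) < (i : ℝ) + 1 := by positivity
        have e2 : (((i : ℝ) + 1) / N) ^ (a * ((a + 1) / a)) = ((i : ℝ) + 1) ^ (a + 1) / n := by
          rw [mul_div_cancel₀ _ (by linarith : a ≠ 0), Real.div_rpow hx0.le hN0.le, hNa]
        have hi := hh i
        rw [e2] at hi
        have hmi := hm0 i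
        have hti := ht0 i
        calc _ ≤ tau i * (C * L ^ q * (((i : ℝ) + 1) ^ (a + 1) / n * m₀ i +
              ((i : ℝ) + 1) ^ a / n)) := by
              refine mul_le_mul_of_nonneg_left (hi.trans ?_) hti
              gcongr
              exact min_le_left _ _
          _ = C * L ^ q * (tau i * ((i : ℝ) + 1) ^ (a + 1) / n) * m₀ i +
              C * L ^ q / n * (tau i * ((i : ℝ) + 1) ^ a) := by ring
          _ ≤ _ := by
              have := div_le_div_of_nonneg_right (hbig i) hn0.le
              gcongr
    _ = C * L ^ q * ((a + 1) * R / n) * ∑ i, m₀ i + C * L ^ q / n * R := by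
        rw [Finset.sum_add_distrib, ← Finset.mul_sum, ← Finset.mul_sum]
    _ ≤ C * L ^ q * ((a + 1) * R / n) * 1 + C * L ^ q / n * R := by gcongr
    _ = _ := by ring

end powerLaw

end

section

/-! ### Finitely supported laws -/

section discreteLaw

variable {B X : Type*} [Fintype B] [MeasurableSpace X]

/-- The measure with mass `p b` at the point `f b`. -/
def discreteLaw (p : B → ℝ) (f : B → X) : Measure X :=
  ∑ b, ENNReal.ofReal (p b) • Measure.dirac (f b)

variable {p : B → ℝ} {f : B → X}

lemma isProbabilityMeasure_discreteLaw (hp : ∀ b, 0 ≤ p b) (h1 : ∑ b, p b = 1) :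
    IsProbabilityMeasure (discreteLaw p f) := by
  refine ⟨?_⟩
  simp only [discreteLaw, Measure.coe_finsetSum, Finset.sum_apply, Measure.smul_apply,
    measure_univ, smul_eq_mul, mul_one]
  rw [← ENNReal.ofReal_sum_of_nonneg fun b _ => hp b, h1, ENNReal.ofReal_one]

lemma ae_discreteLaw {q : X → Prop} (hm : MeasurableSet {x | q x}) (h : ∀ b, q (f b)) :
    ∀ᵐ x ∂(discreteLaw p f), q x := by
  rw [ae_iff, discreteLaw]
  simp only [Measure.coe_finsetSum, Finset.sum_apply, Measure.smul_apply, smul_eq_mul]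
  refine Finset.sum_eq_zero fun b _ => ?_
  have : Measure.dirac (f b) {x | ¬q x} = 0 := by
    rw [show {x | ¬q x} = {x | q x}ᶜ from rfl, Measure.dirac_apply' _ hm.compl]
    simp [h b]
  rw [this, mul_zero]

lemma memLp_discreteLaw (hp : ∀ b, 0 ≤ p b) (h1 : ∑ b, p b = 1) {g : X → ℝ} (hg : Measurable g)
    (r : ENNReal) : MemLp g r (discreteLaw p f) := by
  have := isProbabilityMeasure_discreteLaw (f := f) hp h1
  refine MemLp.of_bound hg.aestronglyMeasurable (∑ b, ‖g (f b)‖) (ae_discreteLaw ?_ fun b =>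
    Finset.single_le_sum (f := fun b => ‖g (f b)‖) (fun b _ => norm_nonneg _) (Finset.mem_univ b))
  exact measurableSet_le hg.norm measurable_const

lemma integrable_discreteLaw (hp : ∀ b, 0 ≤ p b) (h1 : ∑ b, p b = 1) {g : X → ℝ}
    (hg : Measurable g) : Integrable g (discreteLaw p f) :=
  memLp_one_iff_integrable.1 (memLp_discreteLaw hp h1 hg 1)

lemma lintegral_discreteLaw {g : X → ENNReal} (hg : Measurable g) :
    ∫⁻ x, g x ∂(discreteLaw p f) = ∑ b, ENNReal.ofReal (p b) * g (f b) := by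
  rw [discreteLaw, lintegral_finsetSum_measure]
  simp [lintegral_dirac' _ hg]

lemma integral_discreteLaw (hp : ∀ b, 0 ≤ p b) {g : X → ℝ} (hg : Measurable g) :
    ∫ x, g x ∂(discreteLaw p f) = ∑ b, p b * g (f b) := by
  have hi : ∀ b, Integrable g (ENNReal.ofReal (p b) • Measure.dirac (f b)) := fun b => by
    refine Integrable.smul_measure ?_ ENNReal.ofReal_ne_top
    refine ⟨hg.aestronglyMeasurable, ?_⟩
    rw [HasFiniteIntegral, lintegral_dirac' _ hg.enorm]
    exact enorm_lt_top
  rw [discreteLaw, integral_finsetSum_measure fun b _ => hi b]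
  refine Finset.sum_congr rfl fun b _ => ?_
  rw [integral_smul_measure, integral_dirac' _ _ hg.stronglyMeasurable,
    ENNReal.toReal_ofReal (hp b), smul_eq_mul]

lemma map_discreteLaw {Y : Type*} [MeasurableSpace Y] {g : X → Y} (hg : Measurable g) :
    (discreteLaw p f).map g = discreteLaw p (g ∘ f) := by
  ext s hs
  rw [Measure.map_apply hg hs]
  simp only [discreteLaw, Measure.coe_finsetSum, Finset.sum_apply, Measure.smul_apply]
  refine Finset.sum_congr rfl fun b _ => ?_
  rw [Measure.dirac_apply' _ (hg hs), Measure.dirac_apply' _ hs]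
  rfl

lemma discreteLaw_id_singleton [MeasurableSpace B] [MeasurableSingletonClass B] (p : B → ℝ)
    (b : B) : discreteLaw p id {b} = ENNReal.ofReal (p b) := by
  classical
  simp only [discreteLaw, Measure.coe_finsetSum, Finset.sum_apply, Measure.smul_apply,
    smul_eq_mul, id]
  rw [Finset.sum_eq_single b]
  · simp
  · intro c _ hc
    simp [hc]
  · simp

/-- On the finite index type a measure is determined by singletons; the general case is a
pushforward. Repeated points f b are thus allowed. -/
lemma pi_discreteLaw [MeasurableSpace B] [DiscreteMeasurableSpace B] (hp : ∀ b, 0 ≤ p b)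
    (h1 : ∑ b, p b = 1) (n : ℕ) :
    Measure.pi (fun _ : Fin n => discreteLaw p f) =
      discreteLaw (fun ω : Fin n → B => ∏ t, p (ω t)) fun ω t => f (ω t) := by
  classical
  have hprob := isProbabilityMeasure_discreteLaw (f := f) hp h1
  have hprob' := isProbabilityMeasure_discreteLaw (f := (id : B → B)) hp h1
  have hf : Measurable f := .of_discrete
  have e1 : discreteLaw p f = (discreteLaw p (id : B → B)).map f := by
    rw [map_discreteLaw hf, Function.comp_id]
  have e2 : Measure.pi (fun _ : Fin n => discreteLaw p (id : B → B)) =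
      discreteLaw (fun ω : Fin n → B => ∏ t, p (ω t)) id := by
    refine Measure.ext_of_singleton fun ω => ?_
    rw [Measure.pi_singleton, discreteLaw_id_singleton,
      ENNReal.ofReal_prod_of_nonneg fun t _ => hp _]
    exact Finset.prod_congr rfl fun t _ => discreteLaw_id_singleton p (ω t)
  have hm : Measurable fun (ω : Fin n → B) t => f (ω t) :=
    measurable_pi_iff.2 fun t => hf.comp (measurable_pi_apply t)
  have h3 := Measure.pi_map_pi (μ := fun _ : Fin n => discreteLaw p (id : B → B))
    (f := fun _ => f) (fun _ => hf.aemeasurable)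
  rw [e1, ← h3, e2, map_discreteLaw hm]
  rfl

end discreteLaw

/-! ### Rademacher sums -/

section rademacher

variable {d : ℕ}

/-- The sign `±1` encoded by a Boolean. -/
def boolSign (b : Bool) : ℝ := cond b 1 (-1)

lemma boolSign_sq (b : Bool) : boolSign b ^ 2 = 1 := by cases b <;> simp [boolSign]

/-- The Rademacher sum `∑ i, ± g i` with signs `u`. -/
def radSum (g : Fin d → ℝ) (u : Fin d → Bool) : ℝ := ∑ i, g i * boolSign (u i)

lemma radSum_cons (g : Fin (d + 1) → ℝ) (b : Bool) (u : Fin d → Bool) :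
    radSum g (Fin.cons b u) = g 0 * boolSign b + radSum (fun i => g i.succ) u := by
  simp [radSum, Fin.sum_univ_succ]

lemma sum_cube_succ (F : (Fin (d + 1) → Bool) → ℝ) :
    ∑ u, F u = ∑ u : Fin d → Bool, (F (Fin.cons true u) + F (Fin.cons false u)) := by
  rw [← (Fin.consEquiv fun _ => Bool).sum_comp, Fintype.sum_prod_type_right]
  simp [Fin.consEquiv]

lemma sum_radSum_mul (g h : Fin d → ℝ) :
    ∑ u, radSum g u * radSum h u = 2 ^ d * ∑ i, g i * h i := by
  induction d with
  | zero => simp [radSum]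
  | succ d ih =>
    have e : ∀ u : Fin d → Bool, radSum g (Fin.cons true u) * radSum h (Fin.cons true u) +
        radSum g (Fin.cons false u) * radSum h (Fin.cons false u) =
        2 * (radSum (fun i => g i.succ) u * radSum (fun i => h i.succ) u) + 2 * (g 0 * h 0) := by
      intro u
      simp only [radSum_cons, boolSign, cond_true, cond_false]
      ring
    rw [sum_cube_succ, Finset.sum_congr rfl fun u _ => e u, Finset.sum_add_distrib,
      ← Finset.mul_sum, ih, Fin.sum_univ_succ]
    simp
    ring

/-- Khintchine's inequality for the fourth moment, with the Gaussian constant 3. It is proved by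
conditioning on the first sign: odd powers cancel. -/
lemma sum_radSum_pow_four_le (g : Fin d → ℝ) :
    ∑ u, radSum g u ^ 4 ≤ 2 ^ d * (3 * (∑ i, g i ^ 2) ^ 2) := by
  induction d with
  | zero => simp [radSum]
  | succ d ih =>
    have e : ∀ u : Fin d → Bool, radSum g (Fin.cons true u) ^ 4 +
        radSum g (Fin.cons false u) ^ 4 = 2 * radSum (fun i => g i.succ) u ^ 4 +
          12 * g 0 ^ 2 * (radSum (fun i => g i.succ) u * radSum (fun i => g i.succ) u) +
          2 * g 0 ^ 4 := by
      intro u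
      simp only [radSum_cons, boolSign, cond_true, cond_false]
      ring
    rw [sum_cube_succ, Finset.sum_congr rfl fun u _ => e u, Finset.sum_add_distrib,
      Finset.sum_add_distrib, ← Finset.mul_sum, ← Finset.mul_sum, sum_radSum_mul,
      Fin.sum_univ_succ]
    have h := ih fun i => g i.succ
    have e2 : ∑ i : Fin d, g i.succ * g i.succ = ∑ i : Fin d, g i.succ ^ 2 :=
      Finset.sum_congr rfl fun i _ => (sq _).symm
    simp only [e2, Finset.sum_const, Finset.card_univ, Fintype.card_pi, Fintype.card_bool,
      Finset.prod_const, Fintype.card_fin, nsmul_eq_mul, Nat.cast_pow, Nat.cast_ofNat]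
    have h4 : 0 ≤ (2 : ℝ) ^ d * g 0 ^ 4 := by positivity
    rw [pow_succ (2 : ℝ) d]
    linarith

lemma sum_radSum_sq_mul_sq_le (g h : Fin d → ℝ) :
    ∑ u, radSum g u ^ 2 * radSum h u ^ 2 ≤
      2 ^ d * (3 * (∑ i, g i ^ 2) * ∑ i, h i ^ 2) := by
  refine abs_le_of_sq_le_sq' ?_ (by
    have h1 : 0 ≤ ∑ i, g i ^ 2 := Finset.sum_nonneg fun i _ => sq_nonneg _
    have h2 : 0 ≤ ∑ i, h i ^ 2 := Finset.sum_nonneg fun i _ => sq_nonneg _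
    positivity) |>.2
  have hcs := Finset.sum_mul_sq_le_sq_mul_sq Finset.univ (fun u => radSum g u ^ 2)
    fun u => radSum h u ^ 2
  simp only [← pow_mul, Nat.reduceMul] at hcs
  have h0 : 0 ≤ ∑ u, radSum h u ^ 4 := Finset.sum_nonneg fun u _ => by positivity
  calc _ ≤ _ := hcs
    _ ≤ (2 ^ d * (3 * (∑ i, g i ^ 2) ^ 2)) * (2 ^ d * (3 * (∑ i, h i ^ 2) ^ 2)) :=
      mul_le_mul (sum_radSum_pow_four_le g) (sum_radSum_pow_four_le h) h0 (by positivity)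
    _ = _ := by ring

end rademacher

end

section

/-! ### Regression problems with Rademacher covariates and two-point responses -/

section hardProblem

variable {d : ℕ}

/-- The covariate `(± s i)_i` with signs `u`. -/
def design (s : Fin d → ℝ) (u : Fin d → Bool) : Fin d → ℝ := fun i => s i * boolSign (u i)

lemma dotProduct_design (v s : Fin d → ℝ) (u : Fin d → Bool) :
    v ⬝ᵥ design s u = radSum (fun i => v i * s i) u := by
  simp [dotProduct, design, radSum, mul_assoc]

lemma design_eq_radSum (s : Fin d → ℝ) (u : Fin d → Bool) (i : Fin d) :
    design s u i = radSum (Pi.single i (s i)) u := by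
  simp only [design, radSum]
  rw [Finset.sum_eq_single i]
  · simp
  · intro j _ hj
    simp [hj]
  · simp

/-- The law of the covariate with independent coordinates `± s i`. -/
def covariateLaw (s : Fin d → ℝ) : Measure (Fin d → ℝ) :=
  discreteLaw (fun _ : Fin d → Bool => ((2 : ℝ) ^ d)⁻¹) (design s)

lemma sum_cube_inv : ∑ _u : Fin d → Bool, ((2 : ℝ) ^ d)⁻¹ = 1 := by
  simp

lemma isProbabilityMeasure_covariateLaw (s : Fin d → ℝ) :
    IsProbabilityMeasure (covariateLaw s) :=
  isProbabilityMeasure_discreteLaw (fun _ => by positivity) sum_cube_inv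

variable {σ : ℝ}

/-- The modulus of the response at the covariate `x`. -/
def responseScale (σ : ℝ) (w x : Fin d → ℝ) : ℝ := max σ |w ⬝ᵥ x|

/-- The probabilities of the two signs of the response at `x`, which give it the mean
`⟨w, x⟩`. -/
def responseWeight (σ : ℝ) (w x : Fin d → ℝ) (b : Bool) : ℝ :=
  (1 + boolSign b * (w ⬝ᵥ x / responseScale σ w x)) / 2

lemma responseScale_pos (hσ : 0 < σ) (w x : Fin d → ℝ) : 0 < responseScale σ w x :=
  hσ.trans_le (le_max_left _ _)

lemma responseWeight_nonneg (hσ : 0 < σ) (w x : Fin d → ℝ) (b : Bool) :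
    0 ≤ responseWeight σ w x b := by
  have hM := responseScale_pos hσ w x
  have h : |w ⬝ᵥ x / responseScale σ w x| ≤ 1 := by
    rw [abs_div, abs_of_pos hM, div_le_one hM]
    exact le_max_right _ _
  have h2 := abs_le.1 h
  unfold responseWeight
  cases b <;> simp only [boolSign, cond_true, cond_false] <;> linarith

lemma responseWeight_add (w x : Fin d → ℝ) :
    responseWeight σ w x true + responseWeight σ w x false = 1 := by
  simp only [responseWeight, boolSign, cond_true, cond_false]
  ring

lemma responseWeight_sub (hσ : 0 < σ) (w x : Fin d → ℝ) :
    (responseWeight σ w x true - responseWeight σ w x false) * responseScale σ w x = w ⬝ᵥ x := by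
  have hM := responseScale_pos hσ w x
  simp only [responseWeight, boolSign, cond_true, cond_false]
  field_simp
  ring

lemma measurable_dotProduct_right (w : Fin d → ℝ) : Measurable fun x : Fin d → ℝ => w ⬝ᵥ x := by
  refine Continuous.measurable ?_
  unfold dotProduct
  fun_prop

lemma measurable_responseScale (w : Fin d → ℝ) : Measurable fun x => responseScale σ w x :=
  measurable_const.max (measurable_dotProduct_right w).abs

lemma measurable_responseWeight (w : Fin d → ℝ) (b : Bool) :
    Measurable fun x => responseWeight σ w x b :=
  ((((measurable_dotProduct_right w).div (measurable_responseScale w)).const_mul _).const_add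
    1).div_const 2

/-- The conditional law of the response given the covariate. -/
def responseKernel (σ : ℝ) (w : Fin d → ℝ) : Kernel (Fin d → ℝ) ℝ where
  toFun x := discreteLaw (responseWeight σ w x) fun b => boolSign b * responseScale σ w x
  measurable' := by
    refine Measure.measurable_of_measurable_coe _ fun A hA => ?_
    simp only [discreteLaw, Measure.coe_finsetSum, Finset.sum_apply, Measure.smul_apply,
      smul_eq_mul, Measure.dirac_apply' _ hA]
    refine Finset.measurable_sum _ fun b _ => ?_
    exact (measurable_responseWeight w b).ennreal_ofReal.mul
      ((measurable_one.indicator hA).comp ((measurable_responseScale w).const_mul _))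

lemma isMarkovKernel_responseKernel (hσ : 0 < σ) (w : Fin d → ℝ) :
    IsMarkovKernel (responseKernel σ w) := by
  refine ⟨fun x => ?_⟩
  change IsProbabilityMeasure (discreteLaw (responseWeight σ w x)
    fun b => boolSign b * responseScale σ w x)
  refine isProbabilityMeasure_discreteLaw (responseWeight_nonneg hσ w x) ?_
  rw [Fintype.sum_bool]
  exact responseWeight_add w x

/-- The mass function of the pair (signs of the covariate, sign of the response). -/
def labelledWeight (σ : ℝ) (w s : Fin d → ℝ) (c : (Fin d → Bool) × Bool) : ℝ :=
  ((2 : ℝ) ^ d)⁻¹ * responseWeight σ w (design s c.1) c.2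

/-- The observation encoded by the signs of the covariate and of the response. -/
def labelledPoint (σ : ℝ) (w s : Fin d → ℝ) (c : (Fin d → Bool) × Bool) : Sample d :=
  (design s c.1, boolSign c.2 * responseScale σ w (design s c.1))

/-- The law of an observation with covariate law `covariateLaw s` and response kernel
`responseKernel σ w`. -/
def labelledLaw (σ : ℝ) (w s : Fin d → ℝ) : Measure (Sample d) :=
  discreteLaw (labelledWeight σ w s) (labelledPoint σ w s)

lemma labelledWeight_nonneg (hσ : 0 < σ) (w s : Fin d → ℝ) (c : (Fin d → Bool) × Bool) :
    0 ≤ labelledWeight σ w s c :=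
  mul_nonneg (by positivity) (responseWeight_nonneg hσ _ _ _)

lemma sum_labelledWeight (σ : ℝ) (w s : Fin d → ℝ) : ∑ c, labelledWeight σ w s c = 1 := by
  rw [Fintype.sum_prod_type]
  simp only [labelledWeight, Fintype.sum_bool, ← mul_add, responseWeight_add, mul_one]
  exact sum_cube_inv

lemma labelledLaw_eq_compProd (hσ : 0 < σ) (w s : Fin d → ℝ) :
    labelledLaw σ w s = covariateLaw s ⊗ₘ responseKernel σ w := by
  have := isProbabilityMeasure_covariateLaw s
  have := isMarkovKernel_responseKernel hσ w
  ext A hA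
  rw [Measure.compProd_apply hA, covariateLaw,
    lintegral_discreteLaw (Kernel.measurable_kernel_prodMk_left hA)]
  simp only [labelledLaw, discreteLaw, Measure.coe_finsetSum, Finset.sum_apply,
    Measure.smul_apply, smul_eq_mul, Fintype.sum_prod_type]
  refine Finset.sum_congr rfl fun u _ => ?_
  have e : responseKernel σ w (design s u) (Prod.mk (design s u) ⁻¹' A) =
      ∑ b, ENNReal.ofReal (responseWeight σ w (design s u) b) *
        Measure.dirac (labelledPoint σ w s (u, b)) A := by
    change discreteLaw _ _ _ = _
    simp only [discreteLaw, Measure.coe_finsetSum, Finset.sum_apply, Measure.smul_apply,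
      smul_eq_mul]
    refine Finset.sum_congr rfl fun b _ => ?_
    rw [Measure.dirac_apply' _ hA, Measure.dirac_apply' _ (measurable_prodMk_left hA)]
    rfl
  rw [e, Finset.mul_sum]
  refine Finset.sum_congr rfl fun b _ => ?_
  rw [labelledWeight, ENNReal.ofReal_mul (by positivity), mul_assoc]

/-- The kernel does not involve s, so source and target share it. This is where the maximum in
`responseScale` is needed: ⟨w, x⟩ is not bounded by σ on the target support. -/
lemma labelledLaw_disintegration (hσ : 0 < σ) (w s : Fin d → ℝ) :
    labelledLaw σ w s = (labelledLaw σ w s).map Prod.fst ⊗ₘ responseKernel σ w := by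
  have := isProbabilityMeasure_covariateLaw s
  have := isMarkovKernel_responseKernel hσ w
  have h : (labelledLaw σ w s).map Prod.fst = covariateLaw s := by
    rw [labelledLaw_eq_compProd hσ]
    exact Measure.fst_compProd _ _
  rw [h]
  exact labelledLaw_eq_compProd hσ w s

lemma integral_labelledLaw (hσ : 0 < σ) (w s : Fin d → ℝ) {f : Sample d → ℝ}
    (hf : Measurable f) :
    ∫ z, f z ∂(labelledLaw σ w s) = ((2 : ℝ) ^ d)⁻¹ * ∑ u,
      (responseWeight σ w (design s u) true *
          f (design s u, responseScale σ w (design s u)) +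
        responseWeight σ w (design s u) false *
          f (design s u, -responseScale σ w (design s u))) := by
  rw [labelledLaw, integral_discreteLaw (labelledWeight_nonneg hσ w s) hf, Fintype.sum_prod_type,
    Finset.mul_sum]
  refine Finset.sum_congr rfl fun u _ => ?_
  simp only [Fintype.sum_bool, labelledWeight, labelledPoint, boolSign, cond_true, cond_false]
  simp only [one_mul, neg_mul]
  ring

lemma integral_labelledLaw_fst (hσ : 0 < σ) (w s : Fin d → ℝ) {f : (Fin d → ℝ) → ℝ}
    (hf : Measurable f) :
    ∫ z, f z.1 ∂(labelledLaw σ w s) = ((2 : ℝ) ^ d)⁻¹ * ∑ u, f (design s u) := by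
  have h := integral_labelledLaw hσ w s (f := fun z => f z.1) (hf.comp measurable_fst)
  rw [h]
  simp only [← add_mul, responseWeight_add, one_mul]

lemma secondMoment_labelledLaw (hσ : 0 < σ) (w s : Fin d → ℝ) :
    secondMoment (labelledLaw σ w s) = diagonal fun i => s i ^ 2 := by
  ext i j
  simp only [secondMoment, of_apply]
  rw [integral_labelledLaw_fst hσ w s (f := fun x => x i * x j)
    ((measurable_pi_apply i).mul (measurable_pi_apply j))]
  simp_rw [design_eq_radSum]
  rw [sum_radSum_mul, inv_mul_cancel_left₀ (by positivity), diagonal_apply]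
  split
  · next h =>
    subst h
    simp [← sq, Pi.single_apply]
  · next h =>
    refine Finset.sum_eq_zero fun k _ => ?_
    rcases eq_or_ne k i with rfl | hk
    · simp [h]
    · simp [hk]

/-- The conditional mean of y is exactly ⟨w, x⟩, so w is optimal at each covariate value separately.
-/
lemma sqRisk_labelledLaw_le (hσ : 0 < σ) (w s v : Fin d → ℝ) :
    sqRisk (labelledLaw σ w s) w ≤ sqRisk (labelledLaw σ w s) v := by
  have hm : ∀ v : Fin d → ℝ, Measurable fun z : Sample d => (z.2 - v ⬝ᵥ z.1) ^ 2 := fun v =>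
    (measurable_snd.sub ((measurable_dotProduct_right v).comp measurable_fst)).pow_const 2
  unfold sqRisk
  rw [integral_labelledLaw hσ w s (hm w), integral_labelledLaw hσ w s (hm v)]
  refine mul_le_mul_of_nonneg_left (mul_le_mul_of_nonneg_left
    (Finset.sum_le_sum fun u _ => ?_) (by positivity)) (by norm_num)
  simp only
  have h1 := responseWeight_add (σ := σ) w (design s u)
  have h2 := responseWeight_sub hσ w (design s u)
  set p := responseWeight σ w (design s u) true
  set q := responseWeight σ w (design s u) false
  set M := responseScale σ w (design s u)
  rw [← h2]
  have hq : q = 1 - p := by linarith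
  rw [hq]
  nlinarith [sq_nonneg ((p - (1 - p)) * M - v ⬝ᵥ design s u)]

lemma dotProduct_mulVec_of_sum {ι : Type*} [Fintype ι] (k : ℝ) (q : ι → ℝ)
    (x : ι → Fin d → ℝ) (v : Fin d → ℝ) :
    v ⬝ᵥ ((Matrix.of fun i j => k * ∑ u, q u * (x u i * x u j)) *ᵥ v) =
      k * ∑ u, q u * (v ⬝ᵥ x u) ^ 2 := by
  have e : ∀ u, q u * (v ⬝ᵥ x u) ^ 2 = ∑ i, ∑ j, v i * (q u * (x u i * x u j) * v j) := by
    intro u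
    rw [sq, dotProduct, Finset.sum_mul_sum, Finset.mul_sum]
    refine Finset.sum_congr rfl fun i _ => ?_
    rw [Finset.mul_sum]
    exact Finset.sum_congr rfl fun j _ => by ring
  simp_rw [e]
  rw [Finset.sum_comm, Finset.mul_sum]
  simp only [dotProduct, mulVec, of_apply]
  refine Finset.sum_congr rfl fun i _ => ?_
  rw [Finset.sum_comm, Finset.mul_sum, Finset.mul_sum]
  refine Finset.sum_congr rfl fun j _ => ?_
  rw [← Finset.mul_sum, ← Finset.sum_mul]
  ring

lemma dotProduct_diagonal_mulVec (c v : Fin d → ℝ) :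
    v ⬝ᵥ (diagonal c *ᵥ v) = ∑ i, c i * v i ^ 2 := by
  simp only [mulVec_diagonal, dotProduct]
  exact Finset.sum_congr rfl fun i _ => by ring

/-- Writing A = Gᵀ G turns xᵀ A x into a sum of squared Rademacher sums, and
`sum_radSum_sq_mul_sq_le` applies to each row of G. -/
lemma fourthMoment_labelledLaw (hσ : 0 < σ) (w s : Fin d → ℝ) {ψ : ℝ} (hψ : 3 ≤ ψ)
    (A : Matrix (Fin d) (Fin d) ℝ) (hA : A.PosSemidef) :
    ((ψ * ((diagonal fun i => s i ^ 2) * A).trace) • (diagonal fun i => s i ^ 2) -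
      fourthMoment (labelledLaw σ w s) A).PosSemidef := by
  obtain ⟨m, g, hg⟩ := posSemidef_iff_eq_sum_vecMulVec.1 hA
  obtain ⟨G, rfl⟩ : ∃ G : Matrix (Fin m) (Fin d) ℝ, A = Gᵀ * G := by
    refine ⟨Matrix.of g, ?_⟩
    ext i j
    simp [hg, Matrix.sum_apply, vecMulVec_apply, mul_apply]
  have hquad : ∀ u, design s u ⬝ᵥ ((Gᵀ * G) *ᵥ design s u) =
      ∑ k, radSum (fun i => G k i * s i) u ^ 2 := by
    intro u
    rw [← mulVec_mulVec, dotProduct_mulVec, vecMul_transpose, dotProduct]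
    refine Finset.sum_congr rfl fun k _ => ?_
    rw [mulVec, dotProduct_design, sq]
  have htr : ((diagonal fun i => s i ^ 2) * (Gᵀ * G)).trace =
      ∑ k, ∑ i, (G k i * s i) ^ 2 := by
    rw [Finset.sum_comm]
    simp only [Matrix.trace, diag_apply, diagonal_mul]
    simp only [mul_apply, transpose_apply, Finset.mul_sum]
    exact Finset.sum_congr rfl fun i _ => Finset.sum_congr rfl fun k _ => by ring
  have hF : fourthMoment (labelledLaw σ w s) (Gᵀ * G) = Matrix.of fun i j =>
      ((2 : ℝ) ^ d)⁻¹ * ∑ u, (∑ k, radSum (fun i => G k i * s i) u ^ 2) *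
        (design s u i * design s u j) := by
    ext i j
    simp only [fourthMoment, of_apply]
    rw [integral_labelledLaw_fst hσ w s (f := fun x => x ⬝ᵥ ((Gᵀ * G) *ᵥ x) * (x i * x j))]
    · simp_rw [hquad]
    · refine Continuous.measurable ?_
      unfold dotProduct mulVec dotProduct
      fun_prop
  refine PosSemidef.of_dotProduct_mulVec_nonneg ?_ fun v => ?_
  · rw [hF]
    ext i j
    simp only [conjTranspose_apply, Matrix.sub_apply, Matrix.smul_apply, of_apply, diagonal_apply,
      star_trivial]
    congr 1
    · rcases eq_or_ne i j with rfl | h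
      · rfl
      · simp [h, h.symm]
    · congr 1
      exact Finset.sum_congr rfl fun u _ => by ring
  · rw [star_trivial, sub_mulVec, dotProduct_sub, smul_mulVec, dotProduct_smul,
      dotProduct_diagonal_mulVec, hF, dotProduct_mulVec_of_sum, htr, smul_eq_mul, sub_nonneg]
    simp_rw [dotProduct_design, Finset.sum_mul]
    rw [Finset.sum_comm]
    set V := ∑ i, s i ^ 2 * v i ^ 2 with hV
    have hV' : ∑ i, (v i * s i) ^ 2 = V := Finset.sum_congr rfl fun i _ => by ring
    have hV0 : 0 ≤ V := Finset.sum_nonneg fun i _ => by positivity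
    have htr0 : 0 ≤ ∑ k, ∑ i, (G k i * s i) ^ 2 :=
      Finset.sum_nonneg fun k _ => Finset.sum_nonneg fun i _ => sq_nonneg _
    calc _ ≤ ((2 : ℝ) ^ d)⁻¹ * ∑ k, 2 ^ d * (3 * (∑ i, (G k i * s i) ^ 2) * V) := by
          gcongr with k
          rw [← hV']
          exact sum_radSum_sq_mul_sq_le _ _
      _ = 3 * (∑ k, ∑ i, (G k i * s i) ^ 2) * V := by
          rw [← Finset.mul_sum, inv_mul_cancel_left₀ (by positivity), ← Finset.sum_mul,
            ← Finset.mul_sum]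
      _ ≤ _ := by gcongr

/-- On the source support y = ±σ, so the conditional variance of y is σ² - ⟨w, x⟩² ≤ σ². -/
lemma noiseMoment_labelledLaw (hσ : 0 < σ) (w s : Fin d → ℝ)
    (hw : ∀ u, |w ⬝ᵥ design s u| ≤ σ) :
    (σ ^ 2 • (diagonal fun i => s i ^ 2) - noiseMoment (labelledLaw σ w s) w).PosSemidef := by
  have hF : noiseMoment (labelledLaw σ w s) w = Matrix.of fun i j =>
      ((2 : ℝ) ^ d)⁻¹ * ∑ u, (σ ^ 2 - (w ⬝ᵥ design s u) ^ 2) *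
        (design s u i * design s u j) := by
    ext i j
    simp only [noiseMoment, of_apply]
    rw [integral_labelledLaw hσ w s
      (f := fun z => (z.2 - w ⬝ᵥ z.1) ^ 2 * (z.1 i * z.1 j))]
    · congr 1
      refine Finset.sum_congr rfl fun u _ => ?_
      have h1 := responseWeight_add (σ := σ) w (design s u)
      have h2 := responseWeight_sub hσ w (design s u)
      have h3 : responseScale σ w (design s u) = σ := max_eq_left (hw u)
      rw [h3] at h2 ⊢
      simp only
      set p := responseWeight σ w (design s u) true
      set q := responseWeight σ w (design s u) false
      have hq : q = 1 - p := by linarith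
      rw [← h2, hq]
      ring
    · refine Continuous.measurable ?_
      unfold dotProduct
      fun_prop
  refine PosSemidef.of_dotProduct_mulVec_nonneg ?_ fun v => ?_
  · rw [hF]
    ext i j
    simp only [conjTranspose_apply, Matrix.sub_apply, Matrix.smul_apply, of_apply, diagonal_apply,
      star_trivial]
    congr 1
    · rcases eq_or_ne i j with rfl | h
      · rfl
      · simp [h, h.symm]
    · congr 1
      exact Finset.sum_congr rfl fun u _ => by ring
  · rw [star_trivial, sub_mulVec, dotProduct_sub, smul_mulVec, dotProduct_smul,
      dotProduct_diagonal_mulVec, hF, dotProduct_mulVec_of_sum, smul_eq_mul, sub_nonneg]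
    calc _ ≤ ((2 : ℝ) ^ d)⁻¹ * ∑ u, σ ^ 2 * (v ⬝ᵥ design s u) ^ 2 := by
          gcongr with u
          linarith [sq_nonneg (w ⬝ᵥ design s u)]
      _ = _ := by
          simp_rw [dotProduct_design, sq (radSum _ _)]
          rw [← Finset.mul_sum, sum_radSum_mul, mul_left_comm,
            inv_mul_cancel_left₀ (by positivity)]
          congr 1
          exact Finset.sum_congr rfl fun i _ => by ring

lemma isProblem_labelledLaw (hσ : 0 < σ) {ψ : ℝ} (hψ : 3 ≤ ψ) {W : Set (Fin d → ℝ)}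
    {w s : Fin d → ℝ} (t : Fin d → ℝ) (hW : w ∈ W) (hw : ∀ u, |w ⬝ᵥ design s u| ≤ σ) :
    IsProblem W (diagonal fun i => s i ^ 2) (diagonal fun i => t i ^ 2) σ ψ
      (labelledLaw σ w s) (labelledLaw σ w t) w := by
  have hp := fun s => labelledWeight_nonneg hσ w s
  have h1 := sum_labelledWeight σ w
  have hx : ∀ i : Fin d, Measurable fun z : Sample d => z.1 i := fun i =>
    (measurable_pi_apply i).comp measurable_fst
  exact
    { prob_source := isProbabilityMeasure_discreteLaw (hp s) (h1 s)
      prob_target := isProbabilityMeasure_discreteLaw (hp t) (h1 t)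
      memLp_x_source := fun i => memLp_discreteLaw (hp s) (h1 s) (hx i) _
      memLp_x_target := fun i => memLp_discreteLaw (hp t) (h1 t) (hx i) _
      memLp_y_source := memLp_discreteLaw (hp s) (h1 s) measurable_snd _
      memLp_y_target := memLp_discreteLaw (hp t) (h1 t) measurable_snd _
      cov_source := secondMoment_labelledLaw hσ w s
      cov_target := secondMoment_labelledLaw hσ w t
      minimizer_source := sqRisk_labelledLaw_le hσ w s
      minimizer_target := sqRisk_labelledLaw_le hσ w t
      mem_candidates := hW
      fourth_moment := fourthMoment_labelledLaw hσ w s hψ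
      noise_integrable := fun i j => integrable_discreteLaw (hp s) (h1 s) (by
        refine Continuous.measurable ?_
        unfold dotProduct
        fun_prop)
      noise_bound := noiseMoment_labelledLaw hσ w s hw }

lemma mem_covariateShiftClass_labelledLaw (hσ : 0 < σ) {ψ : ℝ} (hψ : 3 ≤ ψ)
    {W : Set (Fin d → ℝ)} {w s : Fin d → ℝ} (t : Fin d → ℝ) (hW : w ∈ W)
    (hw : ∀ u, |w ⬝ᵥ design s u| ≤ σ) :
    (labelledLaw σ w s, labelledLaw σ w t, w) ∈ covariateShiftClass W
      (diagonal fun i => s i ^ 2) (diagonal fun i => t i ^ 2) σ ψ :=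
  ⟨isProblem_labelledLaw hσ hψ t hW hw, responseKernel σ w, isMarkovKernel_responseKernel hσ w,
    labelledLaw_disintegration hσ w s, labelledLaw_disintegration hσ w t⟩

end hardProblem

end

section

/-! ### Lower bounds for the minimax risk -/

section assouad

/-- Le Cam's inequality: by Cauchy–Schwarz (Σ √(pq))² ≤ Σ min · Σ max, and Σ max ≤ 2. -/
lemma sum_min_ge_of_affinity {Ω : Type*} [Fintype Ω] {p q : Ω → ℝ} (hp : ∀ ω, 0 ≤ p ω)
    (hq : ∀ ω, 0 ≤ q ω) (hp1 : ∑ ω, p ω = 1) (hq1 : ∑ ω, q ω = 1)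
    (h : 1 / 2 ≤ ∑ ω, √(p ω * q ω)) : 1 / 8 ≤ ∑ ω, min (p ω) (q ω) := by
  have hcs := Finset.sum_mul_sq_le_sq_mul_sq Finset.univ (fun ω => √(min (p ω) (q ω)))
    fun ω => √(max (p ω) (q ω))
  have h1 : ∀ ω, √(min (p ω) (q ω)) * √(max (p ω) (q ω)) = √(p ω * q ω) := fun ω => by
    rw [← Real.sqrt_mul (le_min (hp ω) (hq ω)), min_mul_max]
  have h2 : ∀ ω, √(min (p ω) (q ω)) ^ 2 = min (p ω) (q ω) := fun ω =>
    Real.sq_sqrt (le_min (hp ω) (hq ω))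
  have h3 : ∀ ω, √(max (p ω) (q ω)) ^ 2 = max (p ω) (q ω) := fun ω =>
    Real.sq_sqrt ((hp ω).trans (le_max_left _ _))
  simp_rw [h1, h2, h3] at hcs
  have hmin0 : 0 ≤ ∑ ω, min (p ω) (q ω) := Finset.sum_nonneg fun ω _ => le_min (hp ω) (hq ω)
  have hmax : ∑ ω, max (p ω) (q ω) ≤ 2 := by
    calc _ ≤ ∑ ω, (p ω + q ω) := Finset.sum_le_sum fun ω _ =>
          max_le (by linarith [hq ω]) (by linarith [hp ω])
      _ = 2 := by rw [Finset.sum_add_distrib, hp1, hq1]; norm_num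
  nlinarith [mul_le_mul_of_nonneg_left hmax hmin0]

/-- The Hellinger affinity is multiplicative over samples, and (1 - 1/(2n))^n ≥ 1/2 by Bernoulli. -/
lemma sum_min_prod_ge {B : Type*} [Fintype B] {p q : B → ℝ} (hp : ∀ b, 0 ≤ p b)
    (hq : ∀ b, 0 ≤ q b) (hp1 : ∑ b, p b = 1) (hq1 : ∑ b, q b = 1) {n : ℕ} (hn : 1 ≤ n)
    (h : 1 - 1 / (2 * n) ≤ ∑ b, √(p b * q b)) :
    1 / 8 ≤ ∑ ω : Fin n → B, min (∏ t, p (ω t)) (∏ t, q (ω t)) := by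
  classical
  have hn0 : (1 : ℝ) ≤ n := by exact_mod_cast hn
  refine sum_min_ge_of_affinity (fun ω => Finset.prod_nonneg fun t _ => hp _)
    (fun ω => Finset.prod_nonneg fun t _ => hq _) ?_ ?_ ?_
  · rw [← Fintype.sum_pow, hp1, one_pow]
  · rw [← Fintype.sum_pow, hq1, one_pow]
  · have e : ∀ ω : Fin n → B, √((∏ t, p (ω t)) * ∏ t, q (ω t)) =
        ∏ t, √(p (ω t) * q (ω t)) := fun ω => by
      rw [← Finset.prod_mul_distrib, Real.sqrt_prod _ fun t _ => mul_nonneg (hp _) (hq _)]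
    simp_rw [e]
    rw [← Fintype.sum_pow fun b => √(p b * q b)]
    have h1 : (1 : ℝ) / (2 * n) ≤ 1 / 2 := by
      rw [div_le_div_iff₀ (by positivity) (by norm_num)]
      linarith
    have h2 := one_add_mul_le_pow (a := -(1 / (2 * n) : ℝ)) (by linarith) n
    have h3 : (n : ℝ) * -(1 / (2 * n)) = -(1 / 2) := by field_simp
    rw [h3] at h2
    calc (1 : ℝ) / 2 ≤ (1 + -(1 / (2 * n))) ^ n := by linarith
      _ ≤ _ := pow_le_pow_left₀ (by linarith) (by linarith) n

variable {d : ℕ}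

/-- The sign pattern `θ` with the sign at `i` reversed. -/
def flipAt (i : Fin d) (θ : Fin d → Bool) : Fin d → Bool := Function.update θ i (!θ i)

lemma flipAt_involutive (i : Fin d) : Function.Involutive (flipAt i) := fun θ => by
  simp [flipAt]

lemma boolSign_not (b : Bool) : boolSign (!b) = -boolSign b := by cases b <;> simp [boolSign]

/-- For each coordinate the sign patterns are paired by flipping that sign. No estimate is close to
both b_i and -b_i, since the two squared errors add up to at least 2b_i², and the overlap of the two
laws has mass at least 1/8. -/
lemma assouad_bound {Ω : Type*} [Fintype Ω] {P : (Fin d → Bool) → Ω → ℝ} {b tau : Fin d → ℝ}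
    (hP : ∀ θ ω, 0 ≤ P θ ω) (htau : ∀ i, 0 ≤ tau i)
    (h : ∀ θ i, 1 / 8 ≤ ∑ ω, min (P θ ω) (P (flipAt i θ) ω)) (e : Ω → Fin d → ℝ) :
    2 ^ d * ∑ i, tau i * b i ^ 2 / 8 ≤
      ∑ θ, ∑ ω, P θ ω * ∑ i, tau i * (e ω i - boolSign (θ i) * b i) ^ 2 := by
  have hi : ∀ i, 2 ^ d * (b i ^ 2 / 8) ≤
      ∑ θ, ∑ ω, P θ ω * (e ω i - boolSign (θ i) * b i) ^ 2 := by
    intro i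
    set F : (Fin d → Bool) → ℝ := fun θ => ∑ ω, P θ ω * (e ω i - boolSign (θ i) * b i) ^ 2
      with hF
    have hflip : ∑ θ, F (flipAt i θ) = ∑ θ, F θ :=
      Equiv.sum_comp (flipAt_involutive i).toPerm F
    have hpair : ∀ θ, b i ^ 2 / 4 ≤ F θ + F (flipAt i θ) := by
      intro θ
      have hs : boolSign (flipAt i θ i) = -boolSign (θ i) := by
        simp [flipAt, boolSign_not]
      simp only [hF, hs]
      rw [← Finset.sum_add_distrib]
      calc b i ^ 2 / 4 ≤ (∑ ω, min (P θ ω) (P (flipAt i θ) ω)) * (2 * b i ^ 2) := by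
            nlinarith [mul_le_mul_of_nonneg_right (h θ i) (sq_nonneg (b i))]
        _ ≤ _ := by
            rw [Finset.sum_mul]
            refine Finset.sum_le_sum fun ω _ => ?_
            set A := e ω i - boolSign (θ i) * b i
            set B := e ω i - -boolSign (θ i) * b i
            have hAB : 2 * b i ^ 2 ≤ A ^ 2 + B ^ 2 := by
              have : A ^ 2 + B ^ 2 = 2 * e ω i ^ 2 + 2 * (boolSign (θ i) ^ 2) * b i ^ 2 := by
                simp only [A, B]
                ring
              rw [this, boolSign_sq]
              nlinarith [sq_nonneg (e ω i)]
            have hm0 : 0 ≤ min (P θ ω) (P (flipAt i θ) ω) := le_min (hP _ _) (hP _ _)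
            calc _ ≤ min (P θ ω) (P (flipAt i θ) ω) * (A ^ 2 + B ^ 2) := by gcongr
              _ = min (P θ ω) (P (flipAt i θ) ω) * A ^ 2 +
                  min (P θ ω) (P (flipAt i θ) ω) * B ^ 2 := mul_add _ _ _
              _ ≤ _ := by
                  gcongr
                  · exact min_le_left _ _
                  · exact min_le_right _ _
    have hsum := Finset.sum_le_sum fun θ (_ : θ ∈ Finset.univ) => hpair θ
    rw [Finset.sum_add_distrib, hflip, Finset.sum_const, Finset.card_univ] at hsum
    simp only [Fintype.card_pi, Fintype.card_bool, Finset.prod_const, Finset.card_univ,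
      Fintype.card_fin, nsmul_eq_mul, Nat.cast_pow, Nat.cast_ofNat] at hsum
    linarith
  calc 2 ^ d * ∑ i, tau i * b i ^ 2 / 8 = ∑ i, tau i * (2 ^ d * (b i ^ 2 / 8)) := by
        rw [Finset.mul_sum]
        exact Finset.sum_congr rfl fun i _ => by ring
    _ ≤ ∑ i, tau i * ∑ θ, ∑ ω, P θ ω * (e ω i - boolSign (θ i) * b i) ^ 2 :=
        Finset.sum_le_sum fun i _ => mul_le_mul_of_nonneg_left (hi i) (htau i)
    _ = _ := by
        simp_rw [Finset.mul_sum]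
        rw [Finset.sum_comm]
        refine Finset.sum_congr rfl fun θ _ => ?_
        rw [Finset.sum_comm]
        exact Finset.sum_congr rfl fun ω _ => Finset.sum_congr rfl fun i _ => by ring

/-- The vertex `(± b i)_i` of a hyperrectangle of regressors. -/
def vertex (b : Fin d → ℝ) (θ : Fin d → Bool) : Fin d → ℝ := fun i => boolSign (θ i) * b i

lemma vertex_sub_flipAt (b : Fin d → ℝ) (θ : Fin d → Bool) (i : Fin d) :
    vertex b θ - vertex b (flipAt i θ) = Pi.single i (2 * boolSign (θ i) * b i) := by
  ext j
  rcases eq_or_ne j i with rfl | hj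
  · simp [vertex, flipAt, boolSign_not]
    ring
  · simp [vertex, flipAt, hj]

variable {σ : ℝ} {s b : Fin d → ℝ}

/-- The possible observations do not depend on w; the regressor only changes their weights. All
hypotheses therefore live on one finite sample space. -/
lemma labelledPoint_eq {w : Fin d → ℝ} (hw : ∀ u, |w ⬝ᵥ design s u| ≤ σ) :
    labelledPoint σ w s = fun c => (design s c.1, boolSign c.2 * σ) := by
  funext c
  rw [labelledPoint, responseScale, max_eq_left (hw c.1)]

/-- The gap (p+q)/2 - √(pq) equals (√p - √q)²/2, and (√p + √q)² ≥ p + q ≥ k/2. -/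
lemma sqrt_mul_ge {k p q : ℝ} (hk : 0 < k) (hp : k / 4 ≤ p) (hq : k / 4 ≤ q) :
    (p + q) / 2 - (p - q) ^ 2 / k ≤ √(p * q) := by
  have hp0 : 0 ≤ p := by linarith
  have hq0 : 0 ≤ q := by linarith
  rw [Real.sqrt_mul hp0]
  have h1 := Real.sq_sqrt hp0
  have h2 := Real.sq_sqrt hq0
  set x := √p
  set y := √q
  have hx : 0 ≤ x := Real.sqrt_nonneg p
  have hy : 0 ≤ y := Real.sqrt_nonneg q
  have h3 : (x - y) ^ 2 * (k / 2) ≤ (p - q) ^ 2 := by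
    rw [← h1, ← h2, show (x ^ 2 - y ^ 2) ^ 2 = (x - y) ^ 2 * (x + y) ^ 2 by ring]
    refine mul_le_mul_of_nonneg_left ?_ (sq_nonneg _)
    nlinarith [mul_nonneg hx hy]
  have h4 : (x - y) ^ 2 / 2 ≤ (p - q) ^ 2 / k := by
    rw [le_div_iff₀ hk]
    linarith
  nlinarith

/-- A flip at i changes each of the 2 · 2^d weights by 2^(-d)|b_i s_i|/σ, so the affinity loses at
most 2 b_i² s_i²/σ² ≤ 1/(2n). The margin σ/2 in `hw` keeps the weights away from 0, as `sqrt_mul_ge`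
requires. -/
lemma labelledWeight_affinity (hσ : 0 < σ) {n : ℕ} (hn : 1 ≤ n)
    (hw : ∀ θ u, |vertex b θ ⬝ᵥ design s u| ≤ σ / 2)
    (hb : ∀ i, 4 * n * (b i ^ 2 * s i ^ 2) ≤ σ ^ 2) (θ : Fin d → Bool) (i : Fin d) :
    1 - 1 / (2 * n) ≤ ∑ c, √(labelledWeight σ (vertex b θ) s c *
      labelledWeight σ (vertex b (flipAt i θ)) s c) := by
  have hn0 : (0 : ℝ) < n := by exact_mod_cast hn
  set k := ((2 : ℝ) ^ d)⁻¹ with hk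
  have hk0 : 0 < k := by positivity
  have hval : ∀ θ c, labelledWeight σ (vertex b θ) s c =
      k * ((1 + boolSign c.2 * (vertex b θ ⬝ᵥ design s c.1 / σ)) / 2) := by
    intro θ c
    rw [labelledWeight, responseWeight, responseScale,
      max_eq_left ((hw θ c.1).trans (by linarith))]
  have hlow : ∀ θ c, k / 4 ≤ labelledWeight σ (vertex b θ) s c := by
    intro θ c
    have h1 : |boolSign c.2 * (vertex b θ ⬝ᵥ design s c.1 / σ)| ≤ 1 / 2 := by
      have hs : |boolSign c.2| = 1 := by cases c.2 <;> simp [boolSign]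
      rw [abs_mul, hs, one_mul, abs_div, abs_of_pos hσ, div_le_iff₀ hσ]
      linarith [hw θ c.1]
    rw [hval]
    nlinarith [(abs_le.1 h1).1]
  have hdiff : ∀ c, (labelledWeight σ (vertex b θ) s c -
      labelledWeight σ (vertex b (flipAt i θ)) s c) ^ 2 / k = k * (b i ^ 2 * s i ^ 2 / σ ^ 2) := by
    intro c
    have h1 : vertex b θ ⬝ᵥ design s c.1 - vertex b (flipAt i θ) ⬝ᵥ design s c.1 =
        2 * boolSign (θ i) * b i * (s i * boolSign (c.1 i)) := by
      rw [← sub_dotProduct, vertex_sub_flipAt, single_dotProduct, design]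
    have h2 : labelledWeight σ (vertex b θ) s c -
        labelledWeight σ (vertex b (flipAt i θ)) s c =
        k * (boolSign c.2 * boolSign (θ i) * boolSign (c.1 i) * (b i * s i) / σ) := by
      rw [hval, hval]
      calc _ = k * boolSign c.2 / (2 * σ) *
            (vertex b θ ⬝ᵥ design s c.1 - vertex b (flipAt i θ) ⬝ᵥ design s c.1) := by
            field_simp
            ring
        _ = _ := by
            rw [h1]
            field_simp
    rw [h2]
    calc _ = k * ((boolSign c.2 ^ 2 * boolSign (θ i) ^ 2 * boolSign (c.1 i) ^ 2) *
          (b i ^ 2 * s i ^ 2) / σ ^ 2) := by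
          field_simp
      _ = _ := by simp only [boolSign_sq, one_mul]
  calc 1 - 1 / (2 * (n : ℝ)) ≤ 1 - 2 * (b i ^ 2 * s i ^ 2 / σ ^ 2) := by
        have : 2 * (b i ^ 2 * s i ^ 2 / σ ^ 2) ≤ 1 / (2 * n) := by
          rw [← mul_div_assoc, div_le_div_iff₀ (by positivity) (by positivity)]
          linarith [hb i]
        linarith
    _ = ∑ c, ((labelledWeight σ (vertex b θ) s c +
          labelledWeight σ (vertex b (flipAt i θ)) s c) / 2 -
          k * (b i ^ 2 * s i ^ 2 / σ ^ 2)) := by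
        rw [Finset.sum_sub_distrib, ← Finset.sum_div, Finset.sum_add_distrib,
          sum_labelledWeight, sum_labelledWeight, Finset.sum_const, Finset.card_univ]
        simp only [Fintype.card_prod, Fintype.card_pi, Fintype.card_bool, Finset.prod_const,
          Finset.card_univ, Fintype.card_fin, nsmul_eq_mul, Nat.cast_mul, Nat.cast_pow,
          Nat.cast_ofNat, hk]
        field_simp
        ring
    _ ≤ _ := by
        refine Finset.sum_le_sum fun c _ => ?_
        rw [← hdiff c]
        exact sqrt_mul_ge hk0 (hlow _ c) (hlow _ c)

lemma estimatorRisk_discreteLaw {B : Type*} [Fintype B] [MeasurableSpace B]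
    [DiscreteMeasurableSpace B] {p : B → ℝ} {f : B → Sample d} (hp : ∀ c, 0 ≤ p c)
    (h1 : ∑ c, p c = 1) {n : ℕ} (T : Matrix (Fin d) (Fin d) ℝ) (w : Fin d → ℝ) {Ξ : Type}
    [MeasurableSpace Ξ] (ν : Measure Ξ) [IsProbabilityMeasure ν]
    {est : (Fin n → Sample d) → Ξ → (Fin d → ℝ)}
    (hest : Measurable fun s : (Fin n → Sample d) × Ξ => est s.1 s.2) :
    estimatorRisk n T (discreteLaw p f) w ν est = ∫⁻ ξ, ∑ ω : Fin n → B,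
      ENNReal.ofReal (∏ τ, p (ω τ)) *
        ENNReal.ofReal (ellipNormSq T (est (fun τ => f (ω τ)) ξ - w)) ∂ν := by
  classical
  have hellm : Measurable fun v : Fin d → ℝ => ellipNormSq T v := by
    refine Continuous.measurable ?_
    unfold ellipNormSq dotProduct mulVec dotProduct
    fun_prop
  have hF : Measurable fun p : (Fin n → Sample d) × Ξ =>
      ENNReal.ofReal (ellipNormSq T (est p.1 p.2 - w)) :=
    (hellm.comp (hest.sub_const _)).ennreal_ofReal
  have hprob : IsProbabilityMeasure (discreteLaw (fun ω : Fin n → B => ∏ t, p (ω t))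
      fun ω t => f (ω t)) :=
    isProbabilityMeasure_discreteLaw (fun ω => Finset.prod_nonneg fun t _ => hp _)
      (by rw [← Fintype.sum_pow p, h1, one_pow])
  rw [estimatorRisk, pi_discreteLaw hp h1, lintegral_prod_symm _ hF.aemeasurable]
  refine lintegral_congr fun ξ => ?_
  exact lintegral_discreteLaw (g := fun x => ENNReal.ofReal (ellipNormSq T (est x ξ - w)))
    (hF.comp measurable_prodMk_right)

/-- The supremum dominates the average over the vertices. For each value of the randomization ξ the
estimator is deterministic, so `assouad_bound` applies under the integral over ξ. -/
lemma le_minimaxRisk_of_rectangle (hσ : 0 < σ) {ψ : ℝ} (hψ : 3 ≤ ψ) {n : ℕ} (hn : 1 ≤ n)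
    {W : Set (Fin d → ℝ)} (t : Fin d → ℝ) (hW : ∀ θ, vertex b θ ∈ W)
    (hw : ∀ θ u, |vertex b θ ⬝ᵥ design s u| ≤ σ / 2)
    (hb : ∀ i, 4 * n * (b i ^ 2 * s i ^ 2) ≤ σ ^ 2) :
    ENNReal.ofReal (∑ i, t i ^ 2 * b i ^ 2 / 8) ≤
      minimaxRisk n (diagonal fun i => t i ^ 2) (covariateShiftClass W
        (diagonal fun i => s i ^ 2) (diagonal fun i => t i ^ 2) σ ψ) := by
  unfold minimaxRisk
  refine le_iInf fun Ξ => le_iInf fun _ => le_iInf fun ν => le_iInf fun hν => le_iInf fun est =>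
    le_iInf fun hest => ?_
  set T : Matrix (Fin d) (Fin d) ℝ := diagonal fun i => t i ^ 2 with hT
  set R := ⨆ p ∈ covariateShiftClass W (diagonal fun i => s i ^ 2) T σ ψ,
    estimatorRisk n T p.1 p.2.2 ν est with hR
  have hwσ : ∀ θ u, |vertex b θ ⬝ᵥ design s u| ≤ σ := fun θ u =>
    (hw θ u).trans (by linarith)
  have hle : ∀ θ, estimatorRisk n T (labelledLaw σ (vertex b θ) s) (vertex b θ) ν est ≤ R :=
    fun θ => le_iSup₂ (f := fun (p : Measure (Sample d) × Measure (Sample d) × (Fin d → ℝ))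
        (_ : p ∈ covariateShiftClass W (diagonal fun i => s i ^ 2) T σ ψ) =>
        estimatorRisk n T p.1 p.2.2 ν est) _
      (mem_covariateShiftClass_labelledLaw hσ hψ t (hW θ) (hwσ θ))
  let pt : (Fin n → (Fin d → Bool) × Bool) → Fin n → Sample d := fun ω τ =>
    (design s (ω τ).1, boolSign (ω τ).2 * σ)
  let pw : (Fin d → Bool) → (Fin n → (Fin d → Bool) × Bool) → ℝ := fun θ ω =>
    ∏ τ, labelledWeight σ (vertex b θ) s (ω τ)
  have hpw : ∀ θ ω, 0 ≤ pw θ ω := fun θ ω =>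
    Finset.prod_nonneg fun τ _ => labelledWeight_nonneg hσ _ _ _
  have hell : ∀ v : Fin d → ℝ, ellipNormSq T v = ∑ i, t i ^ 2 * v i ^ 2 := fun v =>
    dotProduct_diagonal_mulVec _ v
  have hell0 : ∀ v : Fin d → ℝ, 0 ≤ ellipNormSq T v := fun v => by
    rw [hell]
    positivity
  have hellm : Measurable fun v : Fin d → ℝ => ellipNormSq T v := by
    simp_rw [hell]
    fun_prop
  have hrisk : ∀ θ, estimatorRisk n T (labelledLaw σ (vertex b θ) s) (vertex b θ) ν est =
      ∫⁻ ξ, ∑ ω, ENNReal.ofReal (pw θ ω * ellipNormSq T (est (pt ω) ξ - vertex b θ)) ∂ν := by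
    intro θ
    rw [labelledLaw, estimatorRisk_discreteLaw (labelledWeight_nonneg hσ _ s)
      (sum_labelledWeight _ _ s) T _ ν hest, labelledPoint_eq (hwσ θ)]
    exact lintegral_congr fun ξ => Finset.sum_congr rfl fun ω _ =>
      (ENNReal.ofReal_mul (hpw θ ω)).symm
  have hmeas : ∀ θ, Measurable fun ξ => ∑ ω, ENNReal.ofReal
      (pw θ ω * ellipNormSq T (est (pt ω) ξ - vertex b θ)) := fun θ =>
    Finset.measurable_sum _ fun ω _ => ((hellm.comp
      ((hest.comp measurable_prodMk_left).sub_const _)).const_mul _).ennreal_ofReal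
  have hsum : ∑ θ, estimatorRisk n T (labelledLaw σ (vertex b θ) s) (vertex b θ) ν est ≤
      2 ^ d * R := by
    refine (Finset.sum_le_card_nsmul _ _ _ fun θ _ => hle θ).trans_eq ?_
    simp [Finset.card_univ]
  have hlow : ENNReal.ofReal (2 ^ d * ∑ i, t i ^ 2 * b i ^ 2 / 8) ≤
      ∑ θ, estimatorRisk n T (labelledLaw σ (vertex b θ) s) (vertex b θ) ν est := by
    simp_rw [hrisk]
    rw [← lintegral_finsetSum _ fun θ _ => hmeas θ]
    have hconst : ENNReal.ofReal (2 ^ d * ∑ i, t i ^ 2 * b i ^ 2 / 8) =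
        ∫⁻ _ξ, ENNReal.ofReal (2 ^ d * ∑ i, t i ^ 2 * b i ^ 2 / 8) ∂ν := by simp
    rw [hconst]
    refine lintegral_mono fun ξ => ?_
    have h0 : ∀ θ ω, 0 ≤ pw θ ω * ellipNormSq T (est (pt ω) ξ - vertex b θ) := fun θ ω =>
      mul_nonneg (hpw θ ω) (hell0 _)
    simp_rw [← ENNReal.ofReal_sum_of_nonneg fun ω (_ : ω ∈ Finset.univ) => h0 _ ω]
    rw [← ENNReal.ofReal_sum_of_nonneg fun θ _ => Finset.sum_nonneg fun ω _ => h0 θ ω]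
    refine ENNReal.ofReal_le_ofReal ?_
    simp_rw [hell]
    exact assouad_bound hpw (fun i => sq_nonneg (t i)) (fun θ i => sum_min_prod_ge
      (labelledWeight_nonneg hσ _ s) (labelledWeight_nonneg hσ _ s) (sum_labelledWeight _ _ s)
      (sum_labelledWeight _ _ s) hn (labelledWeight_affinity hσ hn hw hb θ i)) fun ω =>
      est (pt ω) ξ
  have hfin := hlow.trans hsum
  rw [ENNReal.ofReal_mul (by positivity), ENNReal.ofReal_pow (by norm_num),
    ENNReal.ofReal_ofNat] at hfin
  exact (ENNReal.mul_le_mul_iff_right (by simp) (by simp)).1 hfin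

end assouad

end

section

/-! ### Rates for power-law spectra -/

section rates

variable {a r σ ψ : ℝ} {d d₀ n : ℕ}

/-- The spectrum `max {i, d₀} ^ (-(1 + r) a)` of the target covariance. -/
def targetSpectrum (a r : ℝ) (d₀ d : ℕ) : Fin d → ℝ :=
  fun i => (max ((i : ℝ) + 1) (d₀ : ℝ)) ^ (-((1 + r) * a))

lemma targetSpectrum_pos (i : Fin d) : 0 < targetSpectrum a r d₀ d i :=
  Real.rpow_pos_of_pos (lt_max_of_lt_left (by positivity)) _

lemma targetSpectrum_antitone (h : 0 ≤ (1 + r) * a) : Antitone (targetSpectrum a r d₀ d) := by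
  intro i j hij
  refine Real.rpow_le_rpow_of_nonpos (lt_max_of_lt_left (by positivity)) ?_ (by linarith)
  have : ((i : ℕ) : ℝ) ≤ ((j : ℕ) : ℝ) := by exact_mod_cast hij
  exact max_le_max (by linarith) le_rfl

lemma targetSpectrum_le_rpow (h : 0 ≤ (1 + r) * a) (i : Fin d) :
    targetSpectrum a r d₀ d i ≤ ((i : ℝ) + 1) ^ (-((1 + r) * a)) :=
  Real.rpow_le_rpow_of_nonpos (by positivity) (le_max_left _ _) (by linarith)

lemma targetSpectrum_le_const (h : 0 ≤ (1 + r) * a) (hd₀ : 1 ≤ d₀) (i : Fin d) :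
    targetSpectrum a r d₀ d i ≤ (d₀ : ℝ) ^ (-((1 + r) * a)) :=
  Real.rpow_le_rpow_of_nonpos (by exact_mod_cast hd₀) (le_max_right _ _) (by linarith)

lemma ellipNormSq_one (w : Fin d → ℝ) : ellipNormSq 1 w = ∑ i, w i ^ 2 := by
  simp [ellipNormSq, dotProduct, sq]

lemma rpow_inv_rpow (ha : 0 < a) (n : ℕ) : ((n : ℝ) ^ (1 / (1 + a))) ^ (a + 1) = n := by
  rw [← Real.rpow_mul (Nat.cast_nonneg n), add_comm a 1, one_div_mul_cancel (by linarith),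
    Real.rpow_one]

lemma rpow_inv_le_iff (ha : 0 < a) (n m : ℕ) :
    (n : ℝ) ^ (1 / (1 + a)) ≤ m ↔ (n : ℝ) ≤ (m : ℝ) ^ (a + 1) := by
  conv_rhs => rw [← rpow_inv_rpow ha n]
  exact (Real.rpow_le_rpow_iff (by positivity) (by positivity) (by linarith)).symm

lemma le_rpow_inv_iff (ha : 0 < a) (n m : ℕ) :
    (m : ℝ) ≤ (n : ℝ) ^ (1 / (1 + a)) ↔ (m : ℝ) ^ (a + 1) ≤ (n : ℝ) := by
  conv_rhs => rw [← rpow_inv_rpow ha n]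
  exact (Real.rpow_le_rpow_iff (by positivity) (by positivity) (by linarith)).symm

lemma natLog_two_le (hn : n ≠ 0) : (Nat.log 2 n : ℝ) ≤ Real.log n / Real.log 2 := by
  have h1 : ((2 : ℝ) ^ Nat.log 2 n) ≤ n := by exact_mod_cast Nat.pow_log_le_self 2 hn
  have h2 := Real.log_le_log (by positivity) h1
  rw [Real.log_pow] at h2
  rwa [le_div_iff₀ (Real.log_pos one_lt_two)]

lemma sgdRisk_powerLaw_le (ha : 1 < a) (hψ : 1 ≤ ψ) (hn : 2 ≤ n) {W : Set (Fin d → ℝ)}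
    {P Q : Measure (Sample d)} {w tau : Fin d → ℝ}
    (h : IsProblem W (diagonal (powerSpectrum a d)) (diagonal tau) σ ψ P Q w)
    (htau : ∀ i, 0 ≤ tau i) :
    sgdRisk n (initialStep a ψ n) (diagonal tau) P w ≤ ENNReal.ofReal (∑ i, tau i *
      errorBound (powerSpectrum a d) σ ψ (stepSize (initialStep a ψ n) n)
        (fun i => w i ^ 2) n i) := by
  have hη := initialStep_pos (n := n) ha hψ (by omega)
  have h2η := two_mul_initialStep_le (n := n) ha hψ (by omega)
  refine sgdRisk_le_errorBound h (fun i => (powerSpectrum_pos i).le) htau (by linarith)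
    fun t i => ?_
  have h1 := stepSize_le (n := n) hη.le t
  have h2 := powerSpectrum_le_one (a := a) (by linarith) i
  have h3 := stepSize_nonneg (n := n) hη.le t
  have h4 := powerSpectrum_pos (a := a) i
  nlinarith

/-- The problem class with power-law spectra and candidate set the unit ball. -/
abbrev powerLawClass (a r σ ψ : ℝ) (d₀ d : ℕ) :
    Set (Measure (Sample d) × Measure (Sample d) × (Fin d → ℝ)) :=
  problemClass (ellipsoid 1) (sourceCov a d) (targetCov a r d₀ d) σ ψ

/-- When N ≤ d₀ the target weights are bounded by d₀^(-(1+r)a) and the case θ = 0 bounds the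
Euclidean error by logarithms; otherwise they are bounded by i^(-(1+r)a) and θ = (1+r)a gives the
decay. -/
lemma exists_sgdRisk_le_rate (ha : 1 < a) (hr : -1 < r) (hra : r < 1 / a) (hψ : 1 ≤ ψ) (σ : ℝ)
    {q : ℕ} (hq : 2 ≤ q) (hrq : 1 + r ≤ q) :
    ∃ C : ℝ, 0 < C ∧ ∀ d d₀ n : ℕ, 1 ≤ d₀ → 2 ≤ n → ∀ p ∈ powerLawClass a r σ ψ d₀ d,
      sgdRisk n (initialStep a ψ n) (targetCov a r d₀ d) p.1 p.2.2 ≤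
        ENNReal.ofReal (C * (Nat.log 2 n : ℝ) ^ (q + 1) *
          (max ((n : ℝ) ^ (1 / (1 + a))) d₀) ^ (-((1 + r) * a))) := by
  have hβ : 0 ≤ (1 + r) * a := mul_nonneg (by linarith) (by linarith)
  have hβa : (1 + r) * a ≤ a + 1 := by
    rw [lt_div_iff₀ (by linarith)] at hra
    linarith
  obtain ⟨C₀, hC₀, h₀⟩ := exists_sum_errorBound_le_rpow ha hψ σ (θ := 0) le_rfl (by linarith)
    (q := q) (by simp) hq
  obtain ⟨C₁, hC₁, h₁⟩ := exists_sum_errorBound_le_rpow ha hψ σ (θ := (1 + r) * a) hβ hβa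
    (q := q) (by rwa [mul_div_cancel_right₀ _ (by linarith : a ≠ 0)]) hq
  refine ⟨C₀ + C₁, by positivity, fun d d₀ n hd₀ hn p hp => ?_⟩
  have hp' : IsProblem _ (diagonal (powerSpectrum a d)) (diagonal (targetSpectrum a r d₀ d)) σ ψ
    p.1 p.2.1 p.2.2 := hp
  have hw : ∑ i, p.2.2 i ^ 2 ≤ 1 := by
    rw [← ellipNormSq_one]
    exact hp'.mem_candidates
  refine (sgdRisk_powerLaw_le ha hψ hn hp' fun i => (targetSpectrum_pos i).le).trans
    (ENNReal.ofReal_le_ofReal ?_)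
  have hn0 : (0 : ℝ) < n := by exact_mod_cast (by omega : 0 < n)
  have hη := initialStep_pos (n := n) ha hψ (by omega)
  have hm0 : ∀ i, 0 ≤ errorBound (powerSpectrum a d) σ ψ (stepSize (initialStep a ψ n) n)
      (fun i => p.2.2 i ^ 2) n i := by
    refine errorBound_nonneg (fun i => (powerSpectrum_pos i).le) (by linarith) (fun t i => ?_)
      (fun i => sq_nonneg _) n
    have h1 := stepSize_le (n := n) hη.le t
    have h2 := powerSpectrum_le_one (a := a) (by linarith) i
    have h3 := stepSize_nonneg (n := n) hη.le t
    have h4 := powerSpectrum_pos (a := a) i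
    have h2η := two_mul_initialStep_le (n := n) ha hψ (by omega)
    nlinarith
  have hL0 : (0 : ℝ) ≤ (Nat.log 2 n : ℝ) ^ (q + 1) := by positivity
  rcases le_total ((n : ℝ) ^ (1 / (1 + a))) d₀ with h | h
  · rw [max_eq_right h]
    have hd0 : (0 : ℝ) < (d₀ : ℝ) ^ (-((1 + r) * a)) :=
      Real.rpow_pos_of_pos (by exact_mod_cast hd₀) _
    have := h₀ d n (fun i => p.2.2 i ^ 2) hn (fun i => sq_nonneg _) hw
    simp only [neg_zero, Real.rpow_zero, one_mul, zero_div, mul_one] at this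
    calc _ ≤ ∑ i, (d₀ : ℝ) ^ (-((1 + r) * a)) * errorBound (powerSpectrum a d) σ ψ
          (stepSize (initialStep a ψ n) n) (fun i => p.2.2 i ^ 2) n i :=
          Finset.sum_le_sum fun i _ => mul_le_mul_of_nonneg_right
            (targetSpectrum_le_const hβ hd₀ i) (hm0 i)
      _ ≤ (d₀ : ℝ) ^ (-((1 + r) * a)) * (C₀ * (Nat.log 2 n : ℝ) ^ (q + 1)) := by
          rw [← Finset.mul_sum]
          gcongr
      _ ≤ (d₀ : ℝ) ^ (-((1 + r) * a)) * ((C₀ + C₁) * (Nat.log 2 n : ℝ) ^ (q + 1)) := by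
          gcongr
          linarith
      _ = _ := mul_comm _ _
  · rw [max_eq_left h, ← Real.rpow_mul hn0.le]
    have e : 1 / (1 + a) * -((1 + r) * a) = -((1 + r) * a / (1 + a)) := by ring
    rw [e]
    calc _ ≤ ∑ i : Fin d, ((i : ℝ) + 1) ^ (-((1 + r) * a)) * errorBound (powerSpectrum a d) σ ψ
          (stepSize (initialStep a ψ n) n) (fun i => p.2.2 i ^ 2) n i :=
          Finset.sum_le_sum fun i _ => mul_le_mul_of_nonneg_right
            (targetSpectrum_le_rpow hβ i) (hm0 i)
      _ ≤ _ := h₁ d n _ hn (fun i => sq_nonneg _) hw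
      _ ≤ _ := by
          gcongr
          linarith

lemma exists_sgdRisk_le_parametric (ha : 1 < a) (hr : -1 < r) (hψ : 1 ≤ ψ) (σ : ℝ)
    {q : ℕ} (hq : 2 ≤ q) :
    ∃ C : ℝ, 0 < C ∧ ∀ d d₀ n : ℕ, 2 ≤ n → ∀ p ∈ powerLawClass a r σ ψ d₀ d,
      sgdRisk n (initialStep a ψ n) (targetCov a r d₀ d) p.1 p.2.2 ≤
        ENNReal.ofReal (C * (Nat.log 2 n : ℝ) ^ q *
          ((∑ i : Fin d, targetSpectrum a r d₀ d i * ((i : ℝ) + 1) ^ a) / n)) := by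
  have hβ : 0 ≤ (1 + r) * a := mul_nonneg (by linarith) (by linarith)
  obtain ⟨C, hC, h⟩ := exists_sum_errorBound_le_parametric ha hψ σ hq
  refine ⟨C, hC, fun d d₀ n hn p hp => ?_⟩
  have hp' : IsProblem _ (diagonal (powerSpectrum a d)) (diagonal (targetSpectrum a r d₀ d)) σ ψ
    p.1 p.2.1 p.2.2 := hp
  have hw : ∑ i, p.2.2 i ^ 2 ≤ 1 := by
    rw [← ellipNormSq_one]
    exact hp'.mem_candidates
  exact (sgdRisk_powerLaw_le ha hψ hn hp' fun i => (targetSpectrum_pos i).le).trans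
    (ENNReal.ofReal_le_ofReal (h d n _ _ hn (fun i => sq_nonneg _) hw
      (fun i => (targetSpectrum_pos i).le) (targetSpectrum_antitone hβ)))

/-- The covariate shift problems in `powerLawClass`. -/
abbrev powerLawShiftClass (a r σ ψ : ℝ) (d₀ d : ℕ) :
    Set (Measure (Sample d) × Measure (Sample d) × (Fin d → ℝ)) :=
  covariateShiftClass (ellipsoid 1) (sourceCov a d) (targetCov a r d₀ d) σ ψ

lemma sum_fin_ite_lt {D : ℕ} (hD : D ≤ d) (f : ℕ → ℝ) :
    ∑ i : Fin d, (if (i : ℕ) < D then f i else 0) = ∑ i ∈ Finset.range D, f i := by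
  rw [← Finset.sum_range fun i => if i < D then f i else 0,
    ← Finset.sum_subset (Finset.range_subset_range.2 hD)]
  · exact Finset.sum_congr rfl fun i hi => if_pos (Finset.mem_range.1 hi)
  · exact fun i _ hi => if_neg fun h => hi (Finset.mem_range.2 h)

/-- The cutoff D is left free: D = ⌊N⌋ gives the rate of the theorem, D = d the matching bound for n
≥ d^(a+1). -/
lemma exists_parametric_le_minimaxRisk (ha : 1 < a) (hσ : 0 < σ) (ψ r : ℝ) :
    ∃ c : ℝ, 0 < c ∧ ∀ d d₀ n D : ℕ, 3 ≤ ψ → 1 ≤ n → D ≤ d → (D : ℝ) ^ (a + 1) ≤ n →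
      ENNReal.ofReal (c * ((∑ i : Fin d, if (i : ℕ) < D then
          targetSpectrum a r d₀ d i * ((i : ℝ) + 1) ^ a else 0) / n)) ≤
        minimaxRisk n (targetCov a r d₀ d) (powerLawShiftClass a r σ ψ d₀ d) := by
  have ha1 : 0 < a - 1 := by linarith
  set Z := 1 + 1 / (a - 1) with hZ
  have hZ1 : 1 ≤ Z := by
    have : 0 < 1 / (a - 1) := by positivity
    linarith
  -- The bound 1 keeps the vertices in the unit ball. The bound σ²/(4Z), with tr S ≤ Z, gives |⟨w,
  -- x⟩| ≤ σ/2 by Cauchy–Schwarz and, as Z ≥ 1, also 4n b_i² s_i² = 4c ≤ σ² on the active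
  -- coordinates.
  set c := min 1 (σ ^ 2 / (4 * Z)) with hc
  have hc0 : 0 < c := by positivity
  have hcZ : c * Z ≤ σ ^ 2 / 4 := by
    have := min_le_right 1 (σ ^ 2 / (4 * Z))
    rw [← hc, le_div_iff₀ (by positivity)] at this
    linarith
  refine ⟨c / 8, by positivity, fun d d₀ n D hψ hn hDd hDn => ?_⟩
  have hn0 : (0 : ℝ) < n := by exact_mod_cast hn
  let s : Fin d → ℝ := fun i => √(powerSpectrum a d i)
  let t : Fin d → ℝ := fun i => √(targetSpectrum a r d₀ d i)
  let b : Fin d → ℝ := fun i => if (i : ℕ) < D then √(c / n * ((i : ℝ) + 1) ^ a) else 0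
  have hs : ∀ i, s i ^ 2 = powerSpectrum a d i := fun i => Real.sq_sqrt (powerSpectrum_pos i).le
  have ht : ∀ i, t i ^ 2 = targetSpectrum a r d₀ d i := fun i =>
    Real.sq_sqrt (targetSpectrum_pos i).le
  have hb : ∀ i, b i ^ 2 = if (i : ℕ) < D then c / n * ((i : ℝ) + 1) ^ a else 0 := fun i => by
    simp only [b]
    split
    · exact Real.sq_sqrt (by positivity)
    · simp
  have hbsum : ∑ i, b i ^ 2 ≤ c := by
    simp_rw [hb]
    rw [sum_fin_ite_lt hDd fun i => c / n * ((i : ℝ) + 1) ^ a, ← Finset.mul_sum]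
    have h1 : ∑ i ∈ Finset.range D, ((i : ℝ) + 1) ^ a ≤ D * (D : ℝ) ^ a := by
      refine (Finset.sum_le_card_nsmul _ _ ((D : ℝ) ^ a) fun i hi => ?_).trans_eq
        (by rw [Finset.card_range, nsmul_eq_mul])
      refine Real.rpow_le_rpow (by positivity) ?_ (by linarith)
      exact_mod_cast Nat.succ_le_of_lt (Finset.mem_range.1 hi)
    have h2 : D * (D : ℝ) ^ a ≤ n := by
      rcases Nat.eq_zero_or_pos D with rfl | hD
      · simp
      · rw [mul_comm, ← Real.rpow_add_one (by positivity)]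
        exact hDn
    calc _ ≤ c / n * n := by gcongr; exact h1.trans h2
      _ = c := div_mul_cancel₀ _ hn0.ne'
  have hvertex : ∀ θ, ∑ i, vertex b θ i ^ 2 = ∑ i, b i ^ 2 := fun θ => by
    simp only [vertex, mul_pow, boolSign_sq, one_mul]
  have hW : ∀ θ, vertex b θ ∈ ellipsoid (1 : Matrix (Fin d) (Fin d) ℝ) := fun θ => by
    change ellipNormSq 1 (vertex b θ) ≤ 1
    rw [ellipNormSq_one, hvertex]
    exact hbsum.trans (min_le_left _ _)
  have hw : ∀ θ u, |vertex b θ ⬝ᵥ design s u| ≤ σ / 2 := fun θ u => by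
    refine abs_le_of_sq_le_sq ?_ (by positivity)
    have h1 : ∑ i, design s u i ^ 2 ≤ Z := by
      simp only [design, mul_pow, boolSign_sq, mul_one, hs]
      exact sum_powerSpectrum_le ha
    calc (vertex b θ ⬝ᵥ design s u) ^ 2
        ≤ (∑ i, vertex b θ i ^ 2) * ∑ i, design s u i ^ 2 :=
          Finset.sum_mul_sq_le_sq_mul_sq _ _ _
      _ ≤ c * Z := by
          rw [hvertex]
          exact mul_le_mul hbsum h1 (Finset.sum_nonneg fun i _ => sq_nonneg _) hc0.le
      _ ≤ σ ^ 2 / 4 := hcZ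
      _ = (σ / 2) ^ 2 := by ring
  have hbs : ∀ i, 4 * n * (b i ^ 2 * s i ^ 2) ≤ σ ^ 2 := fun i => by
    rw [hb, hs, powerSpectrum]
    split
    · have hx : (0 : ℝ) < ((i : ℝ) + 1) ^ a := by positivity
      rw [Real.rpow_neg (by positivity)]
      have e : 4 * (n : ℝ) * (c / n * ((i : ℝ) + 1) ^ a * (((i : ℝ) + 1) ^ a)⁻¹) = 4 * c := by
        field_simp
      rw [e]
      nlinarith
    · simp
      positivity
  have key := le_minimaxRisk_of_rectangle hσ hψ hn t hW hw hbs
  simp_rw [hs, ht] at key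
  refine le_trans (ENNReal.ofReal_le_ofReal ?_) key
  rw [Finset.sum_div, Finset.mul_sum]
  refine Finset.sum_le_sum fun i _ => le_of_eq ?_
  rw [hb]
  split
  · field_simp
  · simp

/-- On coordinates i ≤ N the target weight is at least max(N, d₀)^(-(1+r)a), and Σ_{i ≤ N} i^a is of
order N^(a+1) = n, which cancels the factor 1/n. -/
lemma exists_rate_le_minimaxRisk (ha : 1 < a) (hr : -1 < r) (hσ : 0 < σ) (ψ : ℝ) :
    ∃ c : ℝ, 0 < c ∧ ∀ d d₀ n : ℕ, 3 ≤ ψ → 1 ≤ n → (n : ℝ) ^ (1 / (1 + a)) ≤ d →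
      ENNReal.ofReal (c * (max ((n : ℝ) ^ (1 / (1 + a))) d₀) ^ (-((1 + r) * a))) ≤
        minimaxRisk n (targetCov a r d₀ d) (powerLawShiftClass a r σ ψ d₀ d) := by
  have hβ : 0 ≤ (1 + r) * a := mul_nonneg (by linarith) (by linarith)
  obtain ⟨c, hc, h⟩ := exists_parametric_le_minimaxRisk ha hσ ψ r
  refine ⟨c * (2 ^ (a + 1) * (a + 1))⁻¹, by positivity, fun d d₀ n hψ hn hNd => ?_⟩
  have hn0 : (0 : ℝ) < n := by exact_mod_cast hn
  have hN1 := one_le_rpow_inv (a := a) (n := n) (by linarith) hn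
  have hNa := rpow_inv_rpow (a := a) (by linarith) n
  set N : ℝ := (n : ℝ) ^ (1 / (1 + a)) with hN
  have hN0 : 0 < N := by linarith
  set D := ⌊N⌋₊ with hD
  have hDN : (D : ℝ) ≤ N := Nat.floor_le hN0.le
  have hND : N / 2 ≤ D := by
    have h1 := Nat.lt_floor_add_one N
    have h2 : (1 : ℝ) ≤ D := by exact_mod_cast (Nat.one_le_floor_iff N).2 hN1
    linarith
  have hDd : D ≤ d := by exact_mod_cast hDN.trans hNd
  have hDn : (D : ℝ) ^ (a + 1) ≤ n := by
    rw [← hNa]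
    exact Real.rpow_le_rpow (by positivity) hDN (by linarith)
  refine le_trans (ENNReal.ofReal_le_ofReal ?_) (h d d₀ n D hψ hn hDd hDn)
  set M := max N d₀ with hM
  have hM0 : 0 < M := lt_max_of_lt_left hN0
  rw [mul_assoc]
  refine mul_le_mul_of_nonneg_left ?_ hc.le
  rw [le_div_iff₀ hn0]
  have hsum : M ^ (-((1 + r) * a)) * ∑ i ∈ Finset.range D, ((i : ℝ) + 1) ^ a ≤
      ∑ i : Fin d, if (i : ℕ) < D then targetSpectrum a r d₀ d i * ((i : ℝ) + 1) ^ a else 0 := by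
    rw [← sum_fin_ite_lt hDd, Finset.mul_sum]
    refine Finset.sum_le_sum fun i _ => ?_
    split
    · next hi =>
      refine mul_le_mul_of_nonneg_right ?_ (by positivity)
      refine Real.rpow_le_rpow_of_nonpos (lt_max_of_lt_left (by positivity)) ?_ (by linarith)
      refine max_le_max (le_trans ?_ hDN) le_rfl
      exact_mod_cast hi
    · simp
  refine le_trans ?_ hsum
  have h1 := rpow_le_sum_range (a := a) (by linarith) D
  have h2 : (N / 2) ^ (a + 1) ≤ (D : ℝ) ^ (a + 1) :=
    Real.rpow_le_rpow (by positivity) hND (by linarith)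
  rw [Real.div_rpow hN0.le (by norm_num), hNa] at h2
  have h3 : (2 ^ (a + 1) * (a + 1))⁻¹ * (n : ℝ) ≤ ∑ i ∈ Finset.range D, ((i : ℝ) + 1) ^ a := by
    have e : (2 ^ (a + 1) * (a + 1))⁻¹ * (n : ℝ) = n / 2 ^ (a + 1) / (a + 1) := by
      field_simp
    rw [e, div_le_iff₀ (by linarith)]
    linarith
  calc _ = M ^ (-((1 + r) * a)) * ((2 ^ (a + 1) * (a + 1))⁻¹ * (n : ℝ)) := by ring
    _ ≤ _ := by gcongr

lemma le_ofReal_mul_of_rate {X R : ENNReal} {U V c Y : ℝ} (hX : X ≤ ENNReal.ofReal (U * Y))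
    (hR : ENNReal.ofReal (c * Y) ≤ R) (hU : U ≤ V * c) (hV : 0 ≤ V) (hY : 0 ≤ Y) :
    X ≤ ENNReal.ofReal V * R :=
  calc X ≤ ENNReal.ofReal (U * Y) := hX
    _ ≤ ENNReal.ofReal (V * (c * Y)) := ENNReal.ofReal_le_ofReal (by nlinarith)
    _ = ENNReal.ofReal V * ENNReal.ofReal (c * Y) := ENNReal.ofReal_mul hV
    _ ≤ _ := by gcongr

end rates

end

end

end CovShift

/-! ### Matching the upper and lower bounds -/

theorem mainTheorem8 (a r σ ψ : ℝ) (ha : 1 < a) (hr : -1 < r) (hra : r < 1 / a)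
    (hσ : 0 < σ) (hψ : 1 ≤ ψ) :
    ∃ (η : ℕ → ℝ) (C c : ℝ) (q : ℕ), (∀ n, 0 < η n) ∧ 0 < C ∧ 0 < c ∧
      ∀ d d₀ n : ℕ, 1 ≤ d₀ → d₀ ≤ d → 2 ≤ n →
        -- upper bound for SGD, plateau
        ((n : ℝ) ≤ (d₀ : ℝ) ^ (a + 1) →
          ∀ p ∈ CovShift.problemClass (CovShift.ellipsoid (1 : Matrix (Fin d) (Fin d) ℝ))
              (CovShift.sourceCov a d) (CovShift.targetCov a r d₀ d) σ ψ,
            CovShift.sgdRisk n (η n) (CovShift.targetCov a r d₀ d) p.1 p.2.2 ≤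
              ENNReal.ofReal (C * Real.log n ^ q * (d₀ : ℝ) ^ (-((1 + r) * a)))) ∧
        -- upper bound for SGD, drop
        ((d₀ : ℝ) ^ (a + 1) ≤ (n : ℝ) →
          ∀ p ∈ CovShift.problemClass (CovShift.ellipsoid (1 : Matrix (Fin d) (Fin d) ℝ))
              (CovShift.sourceCov a d) (CovShift.targetCov a r d₀ d) σ ψ,
            CovShift.sgdRisk n (η n) (CovShift.targetCov a r d₀ d) p.1 p.2.2 ≤
              ENNReal.ofReal (C * Real.log n ^ q * (n : ℝ) ^ (-((1 + r) * a / (1 + a))))) ∧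
        (3 ≤ ψ →
          -- optimality of SGD up to logarithmic factors
          (∀ p ∈ CovShift.problemClass (CovShift.ellipsoid (1 : Matrix (Fin d) (Fin d) ℝ))
              (CovShift.sourceCov a d) (CovShift.targetCov a r d₀ d) σ ψ,
            CovShift.sgdRisk n (η n) (CovShift.targetCov a r d₀ d) p.1 p.2.2 ≤
              ENNReal.ofReal (C * Real.log n ^ q) *
                CovShift.minimaxRisk n (CovShift.targetCov a r d₀ d)
                  (CovShift.covariateShiftClass
                    (CovShift.ellipsoid (1 : Matrix (Fin d) (Fin d) ℝ))
                    (CovShift.sourceCov a d) (CovShift.targetCov a r d₀ d) σ ψ)) ∧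
          -- the two rates are lower bounds for every estimator
          ((n : ℝ) ≤ (d₀ : ℝ) ^ (a + 1) →
            ENNReal.ofReal (c * (d₀ : ℝ) ^ (-((1 + r) * a))) ≤
              CovShift.minimaxRisk n (CovShift.targetCov a r d₀ d)
                (CovShift.covariateShiftClass
                  (CovShift.ellipsoid (1 : Matrix (Fin d) (Fin d) ℝ))
                  (CovShift.sourceCov a d) (CovShift.targetCov a r d₀ d) σ ψ)) ∧
          ((d₀ : ℝ) ^ (a + 1) ≤ (n : ℝ) → (n : ℝ) ≤ (d : ℝ) ^ (a + 1) →
            ENNReal.ofReal (c * (n : ℝ) ^ (-((1 + r) * a / (1 + a)))) ≤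
              CovShift.minimaxRisk n (CovShift.targetCov a r d₀ d)
                (CovShift.covariateShiftClass
                  (CovShift.ellipsoid (1 : Matrix (Fin d) (Fin d) ℝ))
                  (CovShift.sourceCov a d) (CovShift.targetCov a r d₀ d) σ ψ))) := by
  have ha0 : 0 < a := by linarith
  set q := 2 + ⌈1 + r⌉₊ with hq
  have hrq : 1 + r ≤ (q : ℝ) := by
    have := Nat.le_ceil (1 + r)
    push_cast [hq]
    linarith
  obtain ⟨C₁, hC₁, hup⟩ :=
    CovShift.exists_sgdRisk_le_rate ha hr hra hψ σ (q := q) (by omega) hrq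
  obtain ⟨C₂, hC₂, hpar⟩ :=
    -- Taking q + 1 here gives both upper bounds the same power of the logarithm.
    CovShift.exists_sgdRisk_le_parametric ha hr hψ σ (q := q + 1) (by omega)
  obtain ⟨c₁, hc₁, hlow⟩ := CovShift.exists_rate_le_minimaxRisk ha hr hσ ψ
  obtain ⟨c₂, hc₂, hlowpar⟩ := CovShift.exists_parametric_le_minimaxRisk ha hσ ψ r
  have hlog2 : 0 < Real.log 2 := Real.log_pos one_lt_two
  set B := ((Real.log 2) ^ (q + 1))⁻¹ with hB
  have hB0 : 0 < B := by positivity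
  have hU₁ : 0 < C₁ * B := by positivity
  have hU₂ : 0 < C₂ * B := by positivity
  -- At n = 0 the step size would be 0; `max n 1` makes it positive for every n without changing it
  -- for n ≥ 1. The constant C is a sum so that it also dominates both ratios of upper to lower
  -- constants.
  refine ⟨fun n => CovShift.initialStep a ψ (max n 1),
    C₁ * B + C₁ * B / c₁ + C₂ * B / c₂, c₁, q + 1,
    fun n => CovShift.initialStep_pos ha hψ (by omega), by positivity, hc₁,
    fun d d₀ n hd₀ hd hn => ?_⟩
  set C := C₁ * B + C₁ * B / c₁ + C₂ * B / c₂ with hC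
  have hC0 : 0 < C := by positivity
  have hCU : C₁ * B ≤ C := by
    have : 0 < C₁ * B / c₁ + C₂ * B / c₂ := by positivity
    linarith
  have hCc₁ : C₁ * B ≤ C * c₁ := by
    rw [← div_le_iff₀ hc₁]
    have : 0 < C₂ * B / c₂ := by positivity
    linarith
  have hCc₂ : C₂ * B ≤ C * c₂ := by
    rw [← div_le_iff₀ hc₂]
    have : 0 < C₁ * B / c₁ := by positivity
    linarith
  have hn1 : max n 1 = n := max_eq_left (by omega)
  simp only [hn1]
  have hn0 : (0 : ℝ) < n := by exact_mod_cast (by omega : 0 < n)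
  have hlogn : 0 ≤ Real.log n := Real.log_nonneg (by exact_mod_cast (by omega : 1 ≤ n))
  have hLpow : (Nat.log 2 n : ℝ) ^ (q + 1) ≤ B * Real.log n ^ (q + 1) := by
    calc _ ≤ (Real.log n / Real.log 2) ^ (q + 1) :=
          pow_le_pow_left₀ (by positivity) (CovShift.natLog_two_le (by omega)) _
      _ = _ := by rw [div_pow, div_eq_inv_mul]
  set Λ := Real.log n ^ (q + 1) with hΛ
  have hΛ0 : 0 ≤ Λ := by positivity
  set N : ℝ := (n : ℝ) ^ (1 / (1 + a)) with hN
  -- The single rate Y is the plateau or the drop according to which of N and d₀ is larger.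
  set Y : ℝ := (max N d₀) ^ (-((1 + r) * a)) with hY
  have hN0 : 0 < N := by positivity
  have hY0 : 0 ≤ Y := Real.rpow_nonneg (hN0.le.trans (le_max_left _ _)) _
  have hupper : ∀ p ∈ CovShift.powerLawClass a r σ ψ d₀ d,
      CovShift.sgdRisk n (CovShift.initialStep a ψ n) (CovShift.targetCov a r d₀ d) p.1 p.2.2 ≤
        ENNReal.ofReal (C₁ * B * Λ * Y) := fun p hp => by
    refine (hup d d₀ n hd₀ hn p hp).trans (ENNReal.ofReal_le_ofReal ?_)
    rw [mul_assoc C₁ B Λ]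
    exact mul_le_mul_of_nonneg_right (mul_le_mul_of_nonneg_left hLpow hC₁.le) hY0
  have hplateau : (n : ℝ) ≤ (d₀ : ℝ) ^ (a + 1) → Y = (d₀ : ℝ) ^ (-((1 + r) * a)) := fun h => by
    rw [hY, max_eq_right ((CovShift.rpow_inv_le_iff ha0 n d₀).2 h)]
  have hdrop : (d₀ : ℝ) ^ (a + 1) ≤ (n : ℝ) → Y = (n : ℝ) ^ (-((1 + r) * a / (1 + a))) :=
    fun h => by
    rw [hY, max_eq_left ((CovShift.le_rpow_inv_iff ha0 n d₀).2 h), ← Real.rpow_mul hn0.le]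
    congr 1
    ring
  have hbound : C₁ * B * Λ * Y ≤ C * Λ * Y := by gcongr
  have hdd : (d₀ : ℝ) ^ (a + 1) ≤ (d : ℝ) ^ (a + 1) :=
    Real.rpow_le_rpow (by positivity) (by exact_mod_cast hd) (by linarith)
  refine ⟨fun h p hp => ?_, fun h p hp => ?_, fun hψ3 => ⟨fun p hp => ?_, fun h => ?_,
    fun h h' => ?_⟩⟩
  · rw [← hplateau h]
    exact (hupper p hp).trans (ENNReal.ofReal_le_ofReal hbound)
  · rw [← hdrop h]
    exact (hupper p hp).trans (ENNReal.ofReal_le_ofReal hbound)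
  -- For n ≤ d^(a+1) both risks are compared with Y, beyond that with Σ τ_i i^a / n.
  · rcases le_total (n : ℝ) ((d : ℝ) ^ (a + 1)) with h | h
    · exact CovShift.le_ofReal_mul_of_rate (hupper p hp)
        (hlow d d₀ n hψ3 (by omega) ((CovShift.rpow_inv_le_iff ha0 n d).2 h))
        (by nlinarith) (by positivity) hY0
    · have hlo := hlowpar d d₀ n d hψ3 (by omega) le_rfl h
      simp only [Fin.is_lt, if_true] at hlo
      have hZ0 : 0 ≤ (∑ i : Fin d, CovShift.targetSpectrum a r d₀ d i * ((i : ℝ) + 1) ^ a) / n :=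
        div_nonneg (Finset.sum_nonneg fun i _ =>
          mul_nonneg (CovShift.targetSpectrum_pos i).le (by positivity)) hn0.le
      refine CovShift.le_ofReal_mul_of_rate (U := C₂ * B * Λ)
        ((hpar d d₀ n hn p hp).trans (ENNReal.ofReal_le_ofReal ?_)) hlo
        (by nlinarith) (by positivity) hZ0
      rw [mul_assoc C₂ B Λ]
      exact mul_le_mul_of_nonneg_right (mul_le_mul_of_nonneg_left hLpow hC₂.le) hZ0
  · rw [← hplateau h]
    exact hlow d d₀ n hψ3 (by omega) ((CovShift.rpow_inv_le_iff ha0 n d).2 (h.trans hdd))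
  · rw [← hdrop h]
    exact hlow d d₀ n hψ3 (by omega) ((CovShift.rpow_inv_le_iff ha0 n d).2 h')
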